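/- Let $d,q\ge 1$ and let $(X,Y),(X_1,Y_1),(X_2,Y_2),\dots$ be i.i.d. $\mathbb{R}^d\times\mathbb{R}^q$-valued random vectors with probability density $f(t,y)$ and $\mathbb{E}\|Y\|<\infty$. Let $K:\mathbb{R}^d\to\mathbb{R}$, $x\in\mathbb{R}^d$, $c>0$, $0<a<1/d$ and $h_n=cn^{-a}$. Define $$\tilde m_n(x)=\frac1n\sum_{i=1}^n\frac{Y_i}{h_i^d}K\Big(\frac{x-X_i}{h_i}\Big),\qquad \tilde g_n(x)=\frac1n\sum_{i=1}^n\frac1{h_i^d}K\Big(\frac{x-X_i}{h_i}\Big),$$ and let $\tilde r_n(x)=\tilde m_n(x)/\tilde g_n(x)$ if $\tilde g_n(x)\neq0$ and $\tilde r_n(x)=0$ otherwise. For $(u,v),(t_1,t_2)\in\mathbb{R}^q\times\mathbb{R}$ and $s\in\mathbb{R}^q$ put $$\tilde\Psi_{a,x}(u,v)=\int_{[0,1]\times\mathbb{R}^d\times\mathbb{R}^q}\sigma^{-ad}\Big(e^{\sigma^{ad}(\langle u,y\rangle+v)K(z)}-1\Big)f(x,y)\,d\sigma\,dz\,dy,$$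 $$\tilde I_{a,x}(t_1,t_2)=\sup_{(u,v)\in\mathbb{R}^q\times\mathbb{R}}\big\{\langle u,t_1\rangle+vt_2-\tilde\Psi_{a,x}(u,v)\big\},$$ $$\tilde J_a^*(s)=\inf_{t\in\mathbb{R},\,t\ne0}\tilde I_{a,x}(st,t),\qquad \tilde J_a(s)=\min\{\tilde J_a^*(s),\tilde I_{a,x}(0,0)\}.$$ Assume: (A1) $K$ is bounded and integrable, $\int_{\mathbb{R}^d}K(z)\,dz=1$ and $\lim_{\|z\|\to\infty}K(z)=0$. (A2) For every $u\in\mathbb{R}^q$, the function $t\mapsto\int_{\mathbb{R}^q}e^{\langle u,y\rangle}f(t,y)\,dy$ is (finite and) bounded on $\mathbb{R}^d$ and continuous at $x$. (A'1) For every $u\in\mathbb{R}^q$, the function $t\mapsto\int_{\mathbb{R}^q}e^{\alpha\langle u,y\rangle}f(t,y)\,dy$ is continuous at $x$ uniformly with respect to $\alpha\in[0,1]$. (C') $\inf_{s\in\mathbb{R}^q}\tilde I_{a,x}(s,0)=\tilde I_{a,x}(0,0)$. Then, for every open subset $U$ of $\mathbb{R}^q$, $$\liminf_{n\to\infty}\frac1{nh_n^d}\log\mathbb{P}[\tilde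 r_n(x)\in U]\ \ge\ -\inf_{s\in U}\tilde J_a^*(s),$$ and for every closed subset $V$ of $\mathbb{R}^q$, $$\limsup_{n\to\infty}\frac1{nh_n^d}\log\mathbb{P}[\tilde r_n(x)\in V]\ \le\ -\inf_{s\in V}\tilde J_a(s),$$ with the conventions $\log 0=-\infty$ and $\inf\emptyset=+\infty$. -/

import Mathlib

open MeasureTheory ProbabilityTheory Filter Topology Set

noncomputable section

namespace SemiRecursive

variable {d q : ℕ} {Ω : Type*}

/-- The bandwidth `h_n = c n^{-a}`. -/
def bandwidth (c a : ℝ) (n : ℕ) : ℝ := c * (n : ℝ) ^ (-a)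

/-- `m̃_n(x) = (1/n) ∑_{i=1}^n Y_i h_i^{-d} K((x - X_i)/h_i)`. -/
def mTilde (K : EuclideanSpace ℝ (Fin d) → ℝ) (h : ℕ → ℝ)
    (X : ℕ → Ω → EuclideanSpace ℝ (Fin d)) (Y : ℕ → Ω → EuclideanSpace ℝ (Fin q))
    (x : EuclideanSpace ℝ (Fin d)) (n : ℕ) (ω : Ω) : EuclideanSpace ℝ (Fin q) :=
  (1 / (n : ℝ)) • ∑ i ∈ Finset.Icc 1 n,
    (1 / h i ^ d * K ((h i)⁻¹ • (x - X i ω))) • Y i ω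

/-- `g̃_n(x) = (1/n) ∑_{i=1}^n h_i^{-d} K((x - X_i)/h_i)`. -/
def gTilde (K : EuclideanSpace ℝ (Fin d) → ℝ) (h : ℕ → ℝ)
    (X : ℕ → Ω → EuclideanSpace ℝ (Fin d))
    (x : EuclideanSpace ℝ (Fin d)) (n : ℕ) (ω : Ω) : ℝ :=
  (1 / (n : ℝ)) * ∑ i ∈ Finset.Icc 1 n, 1 / h i ^ d * K ((h i)⁻¹ • (x - X i ω))

open Classical in
/-- The semi-recursive kernel estimator of the regression: `m̃_n(x) / g̃_n(x)` if
`g̃_n(x) ≠ 0`, and `0` otherwise. -/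
def rTilde (K : EuclideanSpace ℝ (Fin d) → ℝ) (h : ℕ → ℝ)
    (X : ℕ → Ω → EuclideanSpace ℝ (Fin d)) (Y : ℕ → Ω → EuclideanSpace ℝ (Fin q))
    (x : EuclideanSpace ℝ (Fin d)) (n : ℕ) (ω : Ω) : EuclideanSpace ℝ (Fin q) :=
  if gTilde K h X x n ω ≠ 0 then (gTilde K h X x n ω)⁻¹ • mTilde K h X Y x n ω else 0

/-- `f` is a (measurable, nonnegative) joint density of the i.i.d. sequence of random vectors
`(X_i, Y_i)`, and `Y_i` has a finite first moment. The pair of index `0` plays the role of the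
generic pair `(X, Y)`; the estimators use the pairs of index `≥ 1`. -/
structure IsSample [MeasurableSpace Ω] (μ : Measure Ω)
    (X : ℕ → Ω → EuclideanSpace ℝ (Fin d)) (Y : ℕ → Ω → EuclideanSpace ℝ (Fin q))
    (f : EuclideanSpace ℝ (Fin d) → EuclideanSpace ℝ (Fin q) → ℝ) : Prop where
  measurable_density : Measurable (fun p : EuclideanSpace ℝ (Fin d) × EuclideanSpace ℝ (Fin q) =>
    f p.1 p.2)
  density_nonneg : ∀ t y, 0 ≤ f t y
  measurable_X : ∀ i, Measurable (X i)
  measurable_Y : ∀ i, Measurable (Y i)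
  indep : iIndepFun (fun i ω => (X i ω, Y i ω)) μ
  law : ∀ i, μ.map (fun ω => (X i ω, Y i ω)) =
    (volume : Measure (EuclideanSpace ℝ (Fin d) × EuclideanSpace ℝ (Fin q))).withDensity
      (fun p => ENNReal.ofReal (f p.1 p.2))
  integrable_Y : ∀ i, Integrable (Y i) μ

/-- Condition (A1) on the kernel. -/
structure CondA1 (K : EuclideanSpace ℝ (Fin d) → ℝ) : Prop where
  bounded : ∃ C : ℝ, ∀ z, |K z| ≤ C
  integrable : Integrable K volume
  integral_eq_one : ∫ z, K z = 1
  tendsto_zero : Tendsto K (cocompact (EuclideanSpace ℝ (Fin d))) (𝓝 0)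

/-- `∫ e^{⟨u, y⟩} f(t, y) dy`. -/
def expMoment (f : EuclideanSpace ℝ (Fin d) → EuclideanSpace ℝ (Fin q) → ℝ)
    (u : EuclideanSpace ℝ (Fin q)) (t : EuclideanSpace ℝ (Fin d)) : ℝ :=
  ∫ y, Real.exp (inner ℝ u y) * f t y

/-- Condition (A2): for every `u`, the function `t ↦ ∫ e^{⟨u, y⟩} f(t, y) dy` is finite
everywhere, bounded, and continuous at `x`. -/
structure CondA2 (f : EuclideanSpace ℝ (Fin d) → EuclideanSpace ℝ (Fin q) → ℝ)
    (x : EuclideanSpace ℝ (Fin d)) : Prop where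
  integrable : ∀ u t, Integrable (fun y => Real.exp (inner ℝ u y) * f t y) volume
  bounded : ∀ u, ∃ C : ℝ, ∀ t, expMoment f u t ≤ C
  continuousAt : ∀ u, ContinuousAt (expMoment f u) x

/-- Condition (A'1): for every `u`, the function `t ↦ ∫ e^{α⟨u, y⟩} f(t, y) dy` is continuous
at `x`, uniformly in `α ∈ [0, 1]`. -/
def CondA1' (f : EuclideanSpace ℝ (Fin d) → EuclideanSpace ℝ (Fin q) → ℝ)
    (x : EuclideanSpace ℝ (Fin d)) : Prop :=
  ∀ u : EuclideanSpace ℝ (Fin q), ∀ ε > 0, ∃ δ > 0, ∀ t, ‖t - x‖ < δ →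
    ∀ α ∈ Icc (0 : ℝ) 1, |expMoment f (α • u) t - expMoment f (α • u) x| < ε

/-- `Ψ̃_{a,x}(u,v) = ∫_{[0,1]×ℝ^d×ℝ^q} s^{-ad} (e^{s^{ad}(⟨u,y⟩+v)K(z)} - 1) f(x,y) ds dz dy`;
the integration variable is `p = (s, z, y)`. -/
def PsiTilde (K : EuclideanSpace ℝ (Fin d) → ℝ)
    (f : EuclideanSpace ℝ (Fin d) → EuclideanSpace ℝ (Fin q) → ℝ)
    (a : ℝ) (x : EuclideanSpace ℝ (Fin d)) (u : EuclideanSpace ℝ (Fin q)) (v : ℝ) : ℝ :=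
  ∫ p : ℝ × EuclideanSpace ℝ (Fin d) × EuclideanSpace ℝ (Fin q),
    p.1 ^ (-(a * d)) *
      (Real.exp (p.1 ^ (a * d) * ((inner ℝ u p.2.2 + v) * K p.2.1)) - 1) * f x p.2.2
    ∂((volume.restrict (Icc (0 : ℝ) 1)).prod volume)

/-- `Ĩ_{a,x}`, the Fenchel-Legendre transform of `Ψ̃_{a,x}`, with values in `[-∞, ∞]`. -/
def ITilde (K : EuclideanSpace ℝ (Fin d) → ℝ)
    (f : EuclideanSpace ℝ (Fin d) → EuclideanSpace ℝ (Fin q) → ℝ)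
    (a : ℝ) (x : EuclideanSpace ℝ (Fin d)) (t₁ : EuclideanSpace ℝ (Fin q)) (t₂ : ℝ) : EReal :=
  ⨆ (u : EuclideanSpace ℝ (Fin q)) (v : ℝ),
    ((inner ℝ u t₁ + v * t₂ - PsiTilde K f a x u v : ℝ) : EReal)

/-- `J̃*_a(s) = inf_{t ≠ 0} Ĩ_{a,x}(st, t)`. -/
def JStar (K : EuclideanSpace ℝ (Fin d) → ℝ)
    (f : EuclideanSpace ℝ (Fin d) → EuclideanSpace ℝ (Fin q) → ℝ)
    (a : ℝ) (x : EuclideanSpace ℝ (Fin d)) (s : EuclideanSpace ℝ (Fin q)) : EReal :=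
  ⨅ (t : ℝ) (_ : t ≠ 0), ITilde K f a x (t • s) t

/-- `J̃_a(s) = min (J̃*_a(s)) (Ĩ_{a,x}(0, 0))`. -/
def JTilde (K : EuclideanSpace ℝ (Fin d) → ℝ)
    (f : EuclideanSpace ℝ (Fin d) → EuclideanSpace ℝ (Fin q) → ℝ)
    (a : ℝ) (x : EuclideanSpace ℝ (Fin d)) (s : EuclideanSpace ℝ (Fin q)) : EReal :=
  min (JStar K f a x s) (ITilde K f a x 0 0)

/-- Condition (C'): `inf_s Ĩ_{a,x}(s, 0) = Ĩ_{a,x}(0, 0)`. -/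
def CondC' (K : EuclideanSpace ℝ (Fin d) → ℝ)
    (f : EuclideanSpace ℝ (Fin d) → EuclideanSpace ℝ (Fin q) → ℝ)
    (a : ℝ) (x : EuclideanSpace ℝ (Fin d)) : Prop :=
  ⨅ s : EuclideanSpace ℝ (Fin q), ITilde K f a x s 0 = ITilde K f a x 0 0

/-- `(1 / (n h_n^d)) log P[r̃_n(x) ∈ S]`, with `log 0 = -∞`. -/
def scaledLogProb [MeasurableSpace Ω] (μ : Measure Ω) (K : EuclideanSpace ℝ (Fin d) → ℝ)
    (h : ℕ → ℝ) (X : ℕ → Ω → EuclideanSpace ℝ (Fin d))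
    (Y : ℕ → Ω → EuclideanSpace ℝ (Fin q)) (x : EuclideanSpace ℝ (Fin d))
    (S : Set (EuclideanSpace ℝ (Fin q))) (n : ℕ) : EReal :=
  ((1 / ((n : ℝ) * h n ^ d) : ℝ) : EReal) *
    ENNReal.log (μ {ω | rTilde K h X Y x n ω ∈ S})

end SemiRecursive

end

/-! ### The Gärtner-Ellis theorem in finite dimension, for a finite limiting cgf. -/

namespace LargeDeviations

open scoped RealInnerProductSpace ENNReal

variable {E : Type*} [NormedAddCommGroup E] [InnerProductSpace ℝ E]
variable {Ω : Type*} [MeasurableSpace Ω]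

/-! The pair (m̃_n, g̃_n), seen as one vector of ℝ^q × ℝ, satisfies a large deviation principle at
speed n h_n^d with rate Ĩ; the result for the ratio follows by a contraction argument in which only
the hyperplane {g = 0} is delicate.

The principle for the pair is Gärtner-Ellis. By independence the cgf is a sum over i. Since h_n^d /
h_i^d = (i/n)^{ad} (`bandwidth_pow_eq`), the substitution z = (x - X_i)/h_i turns the i-th term into
log(1 + h_n^d b_i), where b_i averages s⁻¹(e^{s(⟨u,y⟩+v)K(z)} - 1) against f(x - h_i z, y), with s =
(i/n)^{ad}. After division by n h_n^d there remains a mean over i ≤ n, asymptotically a Riemann sum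
for Ψ̃ (`IsSample.hasLimitingCgf`). Moreover Ψ̃ is differentiable everywhere
(`CondA2.differentiable_psiTilde`).

In the abstract theorem the upper bound is Chernoff plus a finite cover by half-spaces
(`exists_finset_cover`). The lower bound tilts the law towards a gradient of Ψ
(`HasLimitingCgf.eventually_ball`); a penalised minimisation (`exists_gradient_near`) shows that
gradients suffice, with no appeal to convex duality.

The map (m, g) ↦ m/g is continuous off {g = 0}. The lower bound discards that hyperplane, which
leaves J̃*. The upper bound has to include all of it to keep the set closed; its cost inf_s Ĩ(s, 0)
equals Ĩ(0, 0) by (C'), which is the second term of the minimum in J̃. -/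

/-- The random vectors `Z n` have exponential moments of all orders, and their scaled cumulant
generating functions at speed `r n → ∞` converge pointwise to `Ψ`. -/
structure HasLimitingCgf (μ : Measure Ω) (r : ℕ → ℝ) (Z : ℕ → Ω → E) (Ψ : E → ℝ) : Prop where
  speed : Tendsto r atTop atTop
  measurable : ∀ n l, Measurable fun ω => ⟪l, Z n ω⟫
  integrable : ∀ n l, Integrable (fun ω => Real.exp (r n * ⟪l, Z n ω⟫)) μ
  tendsto : ∀ l, Tendsto (fun n => (r n)⁻¹ * cgf (fun ω => ⟪l, Z n ω⟫) μ (r n)) atTop (𝓝 (Ψ l))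

/-- The Fenchel-Legendre transform of `Ψ`. -/
noncomputable def legendre (Ψ : E → ℝ) (y : E) : EReal := ⨆ l : E, ((⟪l, y⟫ - Ψ l : ℝ) : EReal)

/-- The normalized logarithmic probabilities `r⁻¹ log μ(Z ∈ S)`. -/
noncomputable def scaledLog (μ : Measure Ω) (r : ℕ → ℝ) (Z : ℕ → Ω → E) (S : Set E) (n : ℕ) :
    EReal :=
  (((r n)⁻¹ : ℝ) : EReal) * ENNReal.log (μ {ω | Z n ω ∈ S})

lemma inv_mul_log_exp {r : ℝ} (hr : 0 < r) (c : ℝ) :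
    ((r⁻¹ : ℝ) : EReal) * ENNReal.log (ENNReal.ofReal (Real.exp (r * c))) = c := by
  rw [← EReal.exp_coe, EReal.log_exp, ← EReal.coe_mul, inv_mul_cancel_left₀ hr.ne']

lemma inv_mul_log_le {r c : ℝ} (hr : 0 < r) {m : ℝ≥0∞}
    (h : m ≤ ENNReal.ofReal (Real.exp (r * c))) : ((r⁻¹ : ℝ) : EReal) * ENNReal.log m ≤ c := by
  rw [← inv_mul_log_exp hr c]
  exact mul_le_mul_of_nonneg_left (ENNReal.log_monotone h)
    (EReal.coe_nonneg.2 (inv_nonneg.2 hr.le))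

lemma le_inv_mul_log {r c : ℝ} (hr : 0 < r) {m : ℝ≥0∞}
    (h : ENNReal.ofReal (Real.exp (r * c)) ≤ m) : (c : EReal) ≤ ((r⁻¹ : ℝ) : EReal) * ENNReal.log m := by
  rw [← inv_mul_log_exp hr c]
  exact mul_le_mul_of_nonneg_left (ENNReal.log_monotone h)
    (EReal.coe_nonneg.2 (inv_nonneg.2 hr.le))

/-- Finitely many directions control the norm. -/
lemma exists_finset_norm_le [FiniteDimensional ℝ E] :
    ∃ (S : Finset E) (C : ℝ), 0 < C ∧
      ∀ (w : E) (M : ℝ), 0 ≤ M → (∀ e ∈ S, ⟪e, w⟫ ≤ M) → ‖w‖ ≤ C * M := by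
  classical
  let b := stdOrthonormalBasis ℝ E
  refine ⟨Finset.univ.image (fun i => b i) ∪ Finset.univ.image (fun i => -b i),
    Module.finrank ℝ E + 1, by positivity, fun w M hM h => ?_⟩
  have hi : ∀ i, |⟪b i, w⟫| ≤ M := fun i => by
    refine abs_le.2 ⟨?_, h _ (by simp)⟩
    have := h (-b i) (by simp)
    rw [inner_neg_left] at this
    linarith
  calc ‖w‖ = ‖∑ i, ⟪b i, w⟫ • b i‖ := by rw [b.sum_repr' w]
    _ ≤ ∑ i, ‖⟪b i, w⟫ • b i‖ := norm_sum_le _ _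
    _ ≤ ∑ _i : Fin (Module.finrank ℝ E), M := Finset.sum_le_sum fun i _ => by
        rw [norm_smul, b.norm_eq_one, mul_one]; exact hi i
    _ = Module.finrank ℝ E * M := by simp
    _ ≤ _ := by nlinarith

variable {μ : Measure Ω} {r : ℕ → ℝ} {Z : ℕ → Ω → E} {Ψ : E → ℝ}

lemma HasLimitingCgf.zero [IsProbabilityMeasure μ] (h : HasLimitingCgf μ r Z Ψ) : Ψ 0 = 0 := by
  have h0 := h.tendsto 0
  simp only [inner_zero_left] at h0
  have : ∀ n, (r n)⁻¹ * cgf (fun _ : Ω => (0 : ℝ)) μ (r n) = 0 := fun n => by simp [cgf, mgf]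
  simp only [this] at h0
  exact (tendsto_nhds_unique tendsto_const_nhds h0).symm

/-- Chernoff bound for a half-space. -/
lemma HasLimitingCgf.eventually_halfSpace [IsFiniteMeasure μ] (h : HasLimitingCgf μ r Z Ψ) (l : E)
    (α : ℝ) {ε : ℝ} (hε : 0 < ε) :
    ∀ᶠ n in atTop, μ {ω | α < ⟪l, Z n ω⟫ - Ψ l} ≤ ENNReal.ofReal (Real.exp (r n * (ε - α))) := by
  filter_upwards [(h.tendsto l).eventually_lt_const (show Ψ l < Ψ l + ε by linarith),
    h.speed.eventually_gt_atTop 0] with n hn hr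
  have h1 : μ.real {ω | α + Ψ l ≤ ⟪l, Z n ω⟫} ≤ _ :=
    measure_ge_le_exp_cgf (α + Ψ l) hr.le (h.integrable n l)
  have h2 : cgf (fun ω => ⟪l, Z n ω⟫) μ (r n) ≤ r n * (Ψ l + ε) := by
    rw [inv_mul_lt_iff₀ hr] at hn
    exact hn.le
  calc μ {ω | α < ⟪l, Z n ω⟫ - Ψ l} ≤ μ {ω | α + Ψ l ≤ ⟪l, Z n ω⟫} :=
        measure_mono fun ω hω => by
          simp only [mem_ofPred_eq] at hω ⊢
          linarith
    _ = ENNReal.ofReal (μ.real {ω | α + Ψ l ≤ ⟪l, Z n ω⟫}) := by simp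
    _ ≤ _ := by
        refine ENNReal.ofReal_le_ofReal (h1.trans (Real.exp_le_exp.2 ?_))
        linarith

/-- Plays the role of exponential tightness. The bounded part of F is compact, so finitely many
half-spaces cover it; a far point has a large inner product with one of the finitely many directions
that control the norm, and the half-space of that direction contains it. -/
lemma exists_finset_cover [FiniteDimensional ℝ E] {F : Set E} (hF : IsClosed F) {α : ℝ}
    (hα : ∀ y ∈ F, ∃ l, α < ⟪l, y⟫ - Ψ l) :
    ∃ T : Finset E, ∀ y ∈ F, ∃ l ∈ T, α < ⟪l, y⟫ - Ψ l := by
  classical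
  obtain ⟨S, C, hC, hS⟩ := exists_finset_norm_le (E := E)
  set M := ∑ e ∈ S, |α + Ψ e|
  have hM : 0 ≤ M := Finset.sum_nonneg fun _ _ => abs_nonneg _
  have hK : IsCompact (F ∩ Metric.closedBall 0 (C * M)) :=
    (isCompact_closedBall _ _).inter_left hF
  obtain ⟨t, ht⟩ := hK.elim_finite_subcover (fun l : E => {y : E | α < ⟪l, y⟫ - Ψ l})
    (fun l => isOpen_lt continuous_const (by fun_prop))
    (fun y hy => by
      obtain ⟨l, hl⟩ := hα y hy.1
      exact mem_iUnion.2 ⟨l, hl⟩)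
  refine ⟨t ∪ S, fun y hy => ?_⟩
  by_cases hyS : ∀ e ∈ S, ⟪e, y⟫ ≤ M
  · have := ht ⟨hy, by simpa using hS y M hM hyS⟩
    simp only [mem_iUnion, mem_ofPred_eq] at this
    obtain ⟨l, hl, hl'⟩ := this
    exact ⟨l, Finset.mem_union_left _ hl, hl'⟩
  · push Not at hyS
    obtain ⟨e, he, heM⟩ := hyS
    refine ⟨e, Finset.mem_union_right _ he, ?_⟩
    have : |α + Ψ e| ≤ M := Finset.single_le_sum (f := fun e => |α + Ψ e|)
      (fun _ _ => abs_nonneg _) he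
    linarith [le_abs_self (α + Ψ e)]

/-- Upper bound of the Gärtner-Ellis theorem, for closed sets. -/
theorem HasLimitingCgf.limsup_le [FiniteDimensional ℝ E] [IsFiniteMeasure μ]
    (h : HasLimitingCgf μ r Z Ψ) {F : Set E} (hF : IsClosed F) :
    limsup (scaledLog μ r Z F) atTop ≤ -(⨅ y ∈ F, legendre Ψ y) := by
  rw [← EReal.le_of_forall_lt_iff_le]
  intro c hc
  rw [EReal.neg_lt_comm, ← EReal.coe_neg] at hc
  obtain ⟨α, hcα, hα⟩ := EReal.lt_iff_exists_real_btwn.1 hc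
  have hcα' : -c < α := EReal.coe_lt_coe_iff.1 hcα
  obtain ⟨T, hT⟩ := exists_finset_cover (Ψ := Ψ) hF (α := α) fun y hy => by
    have : (α : EReal) < legendre Ψ y := hα.trans_le (iInf₂_le y hy)
    obtain ⟨l, hl⟩ := lt_iSup_iff.1 this
    exact ⟨l, EReal.coe_lt_coe_iff.1 hl⟩
  -- The tolerance is spent twice, on the Chernoff bounds and on the cardinality of the cover: 2ε -
  -- α = c.
  set ε := (α + c) / 2 with hεdef
  have hε : 0 < ε := by rw [hεdef]; linarith
  have hcard : ∀ᶠ n in atTop, (T.card : ℝ) ≤ Real.exp (r n * ε) :=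
    (Real.tendsto_exp_atTop.comp (h.speed.atTop_mul_const hε)).eventually_ge_atTop _
  refine limsup_le_of_le (by isBoundedDefault) ?_
  filter_upwards [(Finset.eventually_all T).2 fun l _ => h.eventually_halfSpace l α hε, hcard,
    h.speed.eventually_gt_atTop 0] with n hn hcn hr
  refine inv_mul_log_le hr ?_
  calc μ {ω | Z n ω ∈ F} ≤ μ (⋃ l ∈ T, {ω | α < ⟪l, Z n ω⟫ - Ψ l}) :=
        measure_mono fun ω hω => by
          obtain ⟨l, hl, hl'⟩ := hT _ hω
          exact mem_iUnion₂.2 ⟨l, hl, hl'⟩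
    _ ≤ ∑ l ∈ T, μ {ω | α < ⟪l, Z n ω⟫ - Ψ l} := measure_biUnion_finset_le _ _
    _ ≤ ∑ _l ∈ T, ENNReal.ofReal (Real.exp (r n * (ε - α))) := Finset.sum_le_sum hn
    _ = ENNReal.ofReal (T.card * Real.exp (r n * (ε - α))) := by
        rw [Finset.sum_const, nsmul_eq_mul, ENNReal.ofReal_mul (by positivity),
          ENNReal.ofReal_natCast]
    _ ≤ ENNReal.ofReal (Real.exp (r n * ε) * Real.exp (r n * (ε - α))) :=
        ENNReal.ofReal_le_ofReal (by gcongr)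
    _ = _ := by
        rw [← Real.exp_add]
        congr 2
        rw [hεdef]; ring

/-- Under exponential tilting by `l`, the mass concentrates near the gradient of `Ψ` at `l`. -/
lemma HasLimitingCgf.eventually_ball [FiniteDimensional ℝ E] [IsProbabilityMeasure μ]
    (h : HasLimitingCgf μ r Z Ψ) {l y : E}
    (hd : ∀ e, HasDerivAt (fun s : ℝ => Ψ (l + s • e)) ⟪e, y⟫ 0) {δ ε : ℝ} (hδ : 0 < δ)
    (hε : 0 < ε) :
    ∀ᶠ n in atTop, ENNReal.ofReal (Real.exp (r n * (Ψ l - ⟪l, y⟫ - ε))) ≤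
      μ {ω | Z n ω ∈ Metric.ball y δ} := by
  obtain ⟨S, C, hC, hS⟩ := exists_finset_norm_le (E := E)
  -- a radius for the box, small compared with both tolerances
  obtain ⟨κ, hκ, hκδ, hκε⟩ : ∃ κ : ℝ, 0 < κ ∧ C * κ < δ ∧ ‖l‖ * (C * κ) ≤ ε / 3 := by
    have h1 : Tendsto (fun κ : ℝ => C * κ) (𝓝[>] 0) (𝓝 0) :=
      (Continuous.tendsto' (by fun_prop) 0 0 (by simp)).mono_left nhdsWithin_le_nhds
    have h2 : Tendsto (fun κ : ℝ => ‖l‖ * (C * κ)) (𝓝[>] 0) (𝓝 0) :=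
      (Continuous.tendsto' (by fun_prop) 0 0 (by simp)).mono_left nhdsWithin_le_nhds
    obtain ⟨κ, h⟩ := ((h1.eventually_lt_const hδ).and ((h2.eventually_lt_const
      (show 0 < ε / 3 by linarith)).and self_mem_nhdsWithin)).exists
    exact ⟨κ, h.2.2, h.1, h.2.1.le⟩
  -- A small step along e increases Ψ at a slope below ⟨e, y⟩ + κ, so under tilting by l the
  -- Chernoff bound for {⟨e, Z - y⟩ ≥ κ} decays exponentially.
  have hs : ∀ e : E, ∃ s : ℝ, 0 < s ∧ Ψ (l + s • e) - Ψ l < s * (⟪e, y⟫ + κ) := fun e => by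
    have h1 := (hasDerivAt_iff_tendsto_slope.1 (hd e)).eventually_lt_const
      (show ⟪e, y⟫ < ⟪e, y⟫ + κ by linarith)
    have h2 : ∀ᶠ s in 𝓝[>] (0 : ℝ), slope (fun s : ℝ => Ψ (l + s • e)) 0 s < ⟪e, y⟫ + κ :=
      h1.filter_mono (nhdsWithin_mono _ fun s hs => ne_of_gt hs)
    obtain ⟨s, hs, hs0⟩ := (h2.and self_mem_nhdsWithin).exists
    refine ⟨s, hs0, ?_⟩
    have hs0' : (0 : ℝ) < s := hs0
    rw [slope_def_field, sub_zero, div_lt_iff₀ hs0'] at hs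
    simpa [mul_comm] using hs
  choose s hs0 hs using hs
  let L : ℕ → E → ℝ := fun n l => mgf (fun ω => ⟪l, Z n ω⟫) μ (r n)
  have hLpos : ∀ n l, 0 < L n l := fun n l => mgf_pos (h.integrable n l)
  have hlog : ∀ l, Tendsto (fun n => (r n)⁻¹ * Real.log (L n l)) atTop (𝓝 (Ψ l)) := h.tendsto
  -- the mass of the tilted measure outside of the box is small
  have hout : ∀ e : E, ∀ᶠ n in atTop, Real.exp (-(r n * (s e * (⟪e, y⟫ + κ)))) * L n (l + s e • e) ≤
      (2 * (S.card + 1) : ℝ)⁻¹ * L n l := fun e => by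
    set η := s e * (⟪e, y⟫ + κ) - (Ψ (l + s e • e) - Ψ l) with hη
    have hη0 : 0 < η := by rw [hη]; linarith [hs e]
    have ht : Tendsto (fun n => Real.exp (-(r n * (η / 2)))) atTop (𝓝 0) :=
      Real.tendsto_exp_neg_atTop_nhds_zero.comp
        (h.speed.atTop_mul_const (show 0 < η / 2 by linarith))
    filter_upwards [((hlog (l + s e • e)).sub (hlog l)).eventually_lt_const
      (show _ < Ψ (l + s e • e) - Ψ l + η / 2 by linarith), h.speed.eventually_gt_atTop 0,
      ht.eventually_lt_const (show (0 : ℝ) < (2 * (S.card + 1) : ℝ)⁻¹ by positivity)]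
      with n hn hr hsm
    rw [← mul_sub, inv_mul_lt_iff₀ hr] at hn
    rw [← Real.exp_log (hLpos n (l + s e • e)), ← Real.exp_add]
    calc _ ≤ Real.exp (-(r n * (η / 2)) + Real.log (L n l)) := Real.exp_le_exp.2 (by
          rw [hη] at hn ⊢; nlinarith)
      _ = Real.exp (-(r n * (η / 2))) * L n l := by rw [Real.exp_add, Real.exp_log (hLpos n l)]
      _ ≤ _ := mul_le_mul_of_nonneg_right hsm.le (hLpos n l).le
  have hhalf : ∀ᶠ n in atTop, (2 : ℝ) ≤ Real.exp (r n * (ε / 3)) :=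
    (Real.tendsto_exp_atTop.comp (h.speed.atTop_mul_const
      (show 0 < ε / 3 by linarith))).eventually_ge_atTop _
  filter_upwards [(Finset.eventually_all S).2 fun e _ => hout e, hhalf,
    h.speed.eventually_gt_atTop 0,
    (hlog l).eventually_const_lt (show Ψ l - ε / 3 < Ψ l by linarith)] with n hn hn2 hr hnl
  set B : Set Ω := {ω | ∀ e ∈ S, ⟪e, Z n ω - y⟫ < κ} with hB
  have hBm : MeasurableSet B := by
    have : B = ⋂ e ∈ S, {ω | ⟪e, Z n ω⟫ < κ + ⟪e, y⟫} := by
      ext ω; simp [hB, inner_sub_right, sub_lt_iff_lt_add]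
    rw [this]
    exact Finset.measurableSet_biInter S fun e _ =>
      measurableSet_lt (h.measurable n e) measurable_const
  have hBball : B ⊆ {ω | ‖Z n ω - y‖ ≤ C * κ} := fun ω hω =>
    hS _ κ hκ.le fun e he => (hω e he).le
  -- The tilted measure is never constructed: its mass is split pointwise. On the box, ⟨l, Z⟩ is
  -- within ε/3 of ⟨l, y⟩; off it, some direction e violates its constraint and the corresponding
  -- Chernoff term dominates.
  have hpt : ∀ ω, Real.exp (r n * ⟪l, Z n ω⟫) ≤
      B.indicator (fun _ => Real.exp (r n * (⟪l, y⟫ + ε / 3))) ω +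
      ∑ e ∈ S, Real.exp (-(r n * (s e * (⟪e, y⟫ + κ)))) *
        Real.exp (r n * ⟪l + s e • e, Z n ω⟫) := fun ω => by
    by_cases hω : ω ∈ B
    · rw [indicator_of_mem hω]
      refine le_add_of_le_of_nonneg (Real.exp_le_exp.2 ?_)
        (Finset.sum_nonneg fun e _ => by positivity)
      refine mul_le_mul_of_nonneg_left ?_ hr.le
      have h1 : ⟪l, Z n ω - y⟫ ≤ ‖l‖ * ‖Z n ω - y‖ := real_inner_le_norm _ _
      have h2 : ‖l‖ * ‖Z n ω - y‖ ≤ ‖l‖ * (C * κ) :=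
        mul_le_mul_of_nonneg_left (hBball hω) (norm_nonneg _)
      rw [inner_sub_right] at h1
      linarith
    · rw [indicator_of_notMem hω, zero_add]
      simp only [hB, mem_ofPred_eq, not_forall, not_lt] at hω
      obtain ⟨e, he, hek⟩ := hω
      refine le_trans ?_ (Finset.single_le_sum (f := fun e =>
        Real.exp (-(r n * (s e * (⟪e, y⟫ + κ)))) * Real.exp (r n * ⟪l + s e • e, Z n ω⟫))
        (fun e _ => by positivity) he)
      rw [← Real.exp_add, Real.exp_le_exp, inner_add_left, real_inner_smul_left]
      rw [inner_sub_right] at hek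
      have := mul_le_mul_of_nonneg_left
        (mul_le_mul_of_nonneg_left (show ⟪e, y⟫ + κ ≤ ⟪e, Z n ω⟫ by linarith) (hs0 e).le) hr.le
      linarith
  have hint : L n l ≤ μ.real B * Real.exp (r n * (⟪l, y⟫ + ε / 3)) +
      ∑ e ∈ S, Real.exp (-(r n * (s e * (⟪e, y⟫ + κ)))) * L n (l + s e • e) := by
    have hi1 : Integrable (B.indicator fun _ => Real.exp (r n * (⟪l, y⟫ + ε / 3))) μ :=
      (integrable_const _).indicator hBm
    have hi2 : ∀ e ∈ S, Integrable (fun ω => Real.exp (-(r n * (s e * (⟪e, y⟫ + κ)))) *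
        Real.exp (r n * ⟪l + s e • e, Z n ω⟫)) μ := fun e _ => (h.integrable n _).const_mul _
    have := integral_mono (h.integrable n l) (hi1.add (integrable_finsetSum S hi2)) hpt
    simp only [Pi.add_apply] at this
    rw [integral_add hi1 (integrable_finsetSum S hi2), integral_finsetSum S hi2,
      integral_indicator_const _ hBm, smul_eq_mul] at this
    simpa only [integral_const_mul, L, mgf] using this
  -- The factor 2(card + 1) makes the outside mass at most half of the total, and is nonzero even
  -- for empty S.
  have hsum : ∑ e ∈ S, Real.exp (-(r n * (s e * (⟪e, y⟫ + κ)))) * L n (l + s e • e) ≤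
      L n l / 2 := by
    refine (Finset.sum_le_sum hn).trans ?_
    rw [Finset.sum_const, nsmul_eq_mul, ← mul_assoc]
    have : (S.card : ℝ) * (2 * (S.card + 1) : ℝ)⁻¹ ≤ 1 / 2 := by
      rw [← div_eq_mul_inv, div_le_iff₀ (by positivity)]; linarith
    nlinarith [hLpos n l]
  have hLl : Real.exp (r n * (Ψ l - ε / 3)) ≤ L n l := by
    rw [lt_inv_mul_iff₀ hr] at hnl
    rw [← Real.exp_log (hLpos n l)]
    exact Real.exp_le_exp.2 hnl.le
  -- The loss ε consists of three thirds: the convergence of the cgf at l, the oscillation of ⟨l, ·⟩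
  -- on the box, and the factor 2.
  have hmain : Real.exp (r n * (Ψ l - ⟪l, y⟫ - ε)) ≤ μ.real B := by
    have h1 : Real.exp (r n * (Ψ l - ε / 3)) ≤
        2 * (μ.real B * Real.exp (r n * (⟪l, y⟫ + ε / 3))) := by linarith
    have h2 : 2 * (μ.real B * Real.exp (r n * (⟪l, y⟫ + ε / 3))) ≤
        Real.exp (r n * (ε / 3)) * (μ.real B * Real.exp (r n * (⟪l, y⟫ + ε / 3))) :=
      mul_le_mul_of_nonneg_right hn2 (by positivity)
    have h3 : Real.exp (r n * (Ψ l - ε / 3)) = Real.exp (r n * (Ψ l - ⟪l, y⟫ - ε)) *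
        (Real.exp (r n * (ε / 3)) * Real.exp (r n * (⟪l, y⟫ + ε / 3))) := by
      rw [← Real.exp_add, ← Real.exp_add]; congr 1; ring
    have h4 : 0 < Real.exp (r n * (ε / 3)) * Real.exp (r n * (⟪l, y⟫ + ε / 3)) := by positivity
    refine le_of_mul_le_mul_right ?_ h4
    linarith
  calc ENNReal.ofReal (Real.exp (r n * (Ψ l - ⟪l, y⟫ - ε))) ≤ ENNReal.ofReal (μ.real B) :=
        ENNReal.ofReal_le_ofReal hmain
    _ = μ B := by simp
    _ ≤ _ := measure_mono fun ω hω => by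
        rw [mem_ofPred_eq, mem_ball_iff_norm]
        exact (hBball hω).trans_lt hκδ

/-- Every point of finite rate is a limit of gradients `∇Ψ(l)` of no larger rate. -/
lemma exists_gradient_near [FiniteDimensional ℝ E] (hΨ : Differentiable ℝ Ψ) (h0 : Ψ 0 = 0)
    {y : E} {I : ℝ} (hI : ∀ l, ⟪l, y⟫ - Ψ l ≤ I) {δ : ℝ} (hδ : 0 < δ) :
    ∃ l z : E, ‖z - y‖ < δ ∧ (∀ e, HasDerivAt (fun s : ℝ => Ψ (l + s • e)) ⟪e, z⟫ 0) ∧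
      ⟪l, z⟫ - Ψ l ≤ I := by
  have hI0 : 0 ≤ I := by simpa [h0] using hI 0
  -- Chosen so that ‖ε l‖² ≤ 2 I ε < δ² at the minimiser below; the summand 1 covers I = 0.
  set ε : ℝ := δ ^ 2 / (2 * (2 * I + 1)) with hε
  have hε0 : 0 < ε := by positivity
  -- Since Ψ - ⟨·, y⟩ ≥ -I, the quadratic penalty makes Φ coercive. At a minimiser l the first-order
  -- condition reads ∇Ψ(l) = y - ε l, a point near y whose rate is only lowered, by ε‖l‖².
  set Φ : E → ℝ := fun l => Ψ l - ⟪l, y⟫ + ε / 2 * ‖l‖ ^ 2 with hΦ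
  have hcont : Continuous Φ := by
    have := hΨ.continuous
    fun_prop
  have hcoer : Tendsto Φ (cocompact E) atTop := by
    have h1 : Tendsto (fun l : E => ε / 2 * ‖l‖ ^ 2 - I) (cocompact E) atTop :=
      tendsto_atTop_add_const_right _ _ (((tendsto_pow_atTop two_ne_zero).comp
        (tendsto_norm_cocompact_atTop (E := E))).const_mul_atTop (by positivity))
    refine tendsto_atTop_mono (fun l => ?_) h1
    have := hI l
    simp only [hΦ]
    linarith
  obtain ⟨l, hl⟩ := hcont.exists_forall_le hcoer
  have hbound : ε * ‖l‖ ^ 2 ≤ 2 * I := by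
    have h1 := hl 0
    have h2 := hI l
    simp only [hΦ, h0, inner_zero_left, norm_zero] at h1
    linarith
  refine ⟨l, y - ε • l, ?_, fun e => ?_, ?_⟩
  · rw [sub_sub_cancel_left, norm_neg, norm_smul, Real.norm_of_nonneg hε0.le]
    refine lt_of_pow_lt_pow_left₀ 2 hδ.le ?_
    calc (ε * ‖l‖) ^ 2 = ε * (ε * ‖l‖ ^ 2) := by ring
      _ ≤ ε * (2 * I) := by gcongr
      _ < δ ^ 2 := by
        rw [hε, div_mul_eq_mul_div, div_lt_iff₀ (by positivity)]
        nlinarith [pow_pos hδ 2]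
  · have hline : HasDerivAt (fun s : ℝ => l + s • e) e 0 := by
      simpa using ((hasDerivAt_id (0 : ℝ)).smul_const e).const_add l
    have h1 : HasDerivAt (fun s : ℝ => Ψ (l + s • e)) (fderiv ℝ Ψ l e) 0 := by
      have h2 : HasFDerivAt Ψ (fderiv ℝ Ψ l) (l + (0 : ℝ) • e) := by
        simpa using (hΨ l).hasFDerivAt
      exact h2.comp_hasDerivAt 0 hline
    have h2 : HasDerivAt (fun s : ℝ => ⟪l + s • e, y⟫) ⟪e, y⟫ 0 := by
      simpa using hline.inner ℝ (hasDerivAt_const (0 : ℝ) y)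
    have h3 : HasDerivAt (fun s : ℝ => ‖l + s • e‖ ^ 2) (2 * ⟪l, e⟫) 0 := by
      simpa using hline.norm_sq
    have h4 : HasDerivAt (fun s : ℝ => Φ (l + s • e))
        (fderiv ℝ Ψ l e - ⟪e, y⟫ + ε / 2 * (2 * ⟪l, e⟫)) 0 := (h1.sub h2).add (h3.const_mul _)
    have hmin : IsLocalMin (fun s : ℝ => Φ (l + s • e)) 0 :=
      Eventually.of_forall fun s => by simpa using hl (l + s • e)
    have h5 := hmin.hasDerivAt_eq_zero h4
    have h6 : ⟪e, y - ε • l⟫ = fderiv ℝ Ψ l e := by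
      rw [inner_sub_right, real_inner_smul_right, real_inner_comm l e]
      linarith
    rw [h6]
    exact h1
  · rw [inner_sub_right, real_inner_smul_right, real_inner_self_eq_norm_sq]
    have := hI l
    nlinarith [sq_nonneg ‖l‖]

/-- Lower bound of the Gärtner-Ellis theorem, for open sets. -/
theorem HasLimitingCgf.le_liminf [FiniteDimensional ℝ E] [IsProbabilityMeasure μ]
    (h : HasLimitingCgf μ r Z Ψ) (hΨ : Differentiable ℝ Ψ) {G : Set E} (hG : IsOpen G) :
    -(⨅ y ∈ G, legendre Ψ y) ≤ liminf (scaledLog μ r Z G) atTop := by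
  rw [EReal.neg_le]
  refine le_iInf₂ fun y hy => ?_
  rw [EReal.neg_le, ← EReal.ge_of_forall_gt_iff_ge]
  intro c hc
  rw [EReal.lt_neg_comm] at hc
  obtain ⟨I, hI1, hI2⟩ := EReal.lt_iff_exists_real_btwn.1 hc
  have hIc : I < -c := by
    rw [← EReal.coe_neg] at hI2
    exact EReal.coe_lt_coe_iff.1 hI2
  obtain ⟨ρ, hρ, hball⟩ := Metric.isOpen_iff.1 hG y hy
  obtain ⟨l, z, hz, hd, hlz⟩ := exists_gradient_near hΨ h.zero (y := y) (I := I)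
    (fun l => EReal.coe_le_coe_iff.1 ((le_iSup (fun l : E => ((⟪l, y⟫ - Ψ l : ℝ) : EReal)) l).trans
      hI1.le)) (half_pos hρ)
  refine le_liminf_of_le (by isBoundedDefault) ?_
  -- The tolerance -c - I is exactly the gap between the rate bound I and the target exponent -c.
  filter_upwards [h.eventually_ball hd (half_pos hρ) (show 0 < -c - I by linarith),
    h.speed.eventually_gt_atTop 0] with n hn hr
  refine le_inv_mul_log hr (le_trans ?_ (hn.trans (measure_mono fun ω hω => hball ?_)))
  · refine ENNReal.ofReal_le_ofReal (Real.exp_le_exp.2 (mul_le_mul_of_nonneg_left ?_ hr.le))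
    linarith
  · rw [mem_ofPred_eq, Metric.mem_ball] at hω
    rw [← dist_eq_norm] at hz
    rw [Metric.mem_ball]
    linarith [dist_triangle (Z n ω) z y]

end LargeDeviations

/-! ### Exponential moments of the density and convergence of kernel averages. -/

namespace SemiRecursive

open scoped RealInnerProductSpace ENNReal

variable {d q : ℕ} {f : EuclideanSpace ℝ (Fin d) → EuclideanSpace ℝ (Fin q) → ℝ}
  {x : EuclideanSpace ℝ (Fin d)} {K : EuclideanSpace ℝ (Fin d) → ℝ}

lemma abs_exp_sub_one_le_mul_exp (a : ℝ) : |Real.exp a - 1| ≤ |a| * Real.exp |a| := by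
  have h1 : Real.exp a * (1 - a) ≤ 1 := by
    have := mul_le_mul_of_nonneg_left (Real.add_one_le_exp (-a)) (Real.exp_pos a).le
    rw [← Real.exp_add, add_neg_cancel, Real.exp_zero] at this
    linarith
  rcases le_total 0 a with h | h
  · rw [abs_of_nonneg h, abs_of_nonneg (by linarith [Real.add_one_le_exp a])]
    linarith
  · rw [abs_of_nonpos h, abs_of_nonpos (by linarith [Real.exp_le_one_iff.2 h])]
    have h2 := Real.add_one_le_exp a
    have h3 := Real.one_le_exp (neg_nonneg.2 h)
    nlinarith

/-- The factor s from the exponent cancels s⁻¹, so the bound is uniform as s → 0. One factor |k| is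
kept in front: with k = K(z), it supplies integrability in z. -/
lemma abs_inv_mul_exp_sub_one_le {s k w C : ℝ} (hs : 0 < s) (hs1 : s ≤ 1) (hk : |k| ≤ C) :
    |s⁻¹ * (Real.exp (s * (w * k)) - 1)| ≤ |k| * Real.exp ((C + 1) * |w|) := by
  have hC : 0 ≤ C := (abs_nonneg k).trans hk
  have h1 : |s * (w * k)| ≤ C * |w| := by
    rw [abs_mul, abs_mul, abs_of_pos hs]
    calc s * (|w| * |k|) ≤ 1 * (|w| * C) := by gcongr
      _ = C * |w| := by ring
  calc |s⁻¹ * (Real.exp (s * (w * k)) - 1)|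
      = s⁻¹ * |Real.exp (s * (w * k)) - 1| := by rw [abs_mul, abs_of_pos (inv_pos.2 hs)]
    _ ≤ s⁻¹ * (|s * (w * k)| * Real.exp |s * (w * k)|) := by
        gcongr; exact abs_exp_sub_one_le_mul_exp _
    _ = |k| * (|w| * Real.exp |s * (w * k)|) := by
        rw [abs_mul s, abs_mul, abs_of_pos hs]; field_simp
    _ ≤ |k| * (Real.exp |w| * Real.exp (C * |w|)) := by
        gcongr
        linarith [Real.add_one_le_exp |w|]
    _ = |k| * Real.exp ((C + 1) * |w|) := by rw [← Real.exp_add]; ring_nf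

lemma exp_mul_abs_inner_add_le (u y : EuclideanSpace ℝ (Fin q)) (v : ℝ) {R : ℝ} (hR : 0 ≤ R) :
    Real.exp (R * |⟪u, y⟫ + v|) ≤ Real.exp (R * |v|) * Real.exp (R * ‖u‖ * ‖y‖) := by
  rw [← Real.exp_add, Real.exp_le_exp]
  have h1 : |⟪u, y⟫ + v| ≤ ‖u‖ * ‖y‖ + |v| :=
    (abs_add_le _ _).trans (by gcongr; exact abs_real_inner_le_norm u y)
  nlinarith

/-- The density has exponential moments of all orders in `y`, uniformly in `t`. -/
lemma CondA2.exists_exp_norm_bound (hA2 : CondA2 f x)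
    (hfm : Measurable fun p : EuclideanSpace ℝ (Fin d) × EuclideanSpace ℝ (Fin q) => f p.1 p.2)
    (hf0 : ∀ t y, 0 ≤ f t y) {R : ℝ} (hR : 0 ≤ R) :
    ∃ M, 0 ≤ M ∧ ∀ t, Integrable (fun y => Real.exp (R * ‖y‖) * f t y) ∧
      ∫ y, Real.exp (R * ‖y‖) * f t y ≤ M := by
  obtain ⟨S, C, hC, hS⟩ :=
    LargeDeviations.exists_finset_norm_le (E := EuclideanSpace ℝ (Fin q))
  choose B hB using hA2.bounded
  -- For y ≠ 0 some direction e has ⟨e, y⟩ > ‖y‖/(2C), as otherwise ‖y‖ ≤ ‖y‖/2; hence the scaling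
  -- 2CR. The summand with exponent 0 handles y = 0.
  have hpt : ∀ y : EuclideanSpace ℝ (Fin q), Real.exp (R * ‖y‖) ≤
      Real.exp ⟪0, y⟫ + ∑ e ∈ S, Real.exp ⟪(2 * C * R) • e, y⟫ := fun y => by
    rcases eq_or_ne y 0 with rfl | hy
    · simp only [norm_zero, mul_zero, inner_zero_left, Real.exp_zero]
      exact le_add_of_nonneg_right (Finset.sum_nonneg fun e _ => (Real.exp_pos _).le)
    · have hy' : 0 < ‖y‖ := norm_pos_iff.2 hy
      have : ∃ e ∈ S, ‖y‖ / (2 * C) < ⟪e, y⟫ := by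
        by_contra! hcon
        have := hS y (‖y‖ / (2 * C)) (by positivity) hcon
        have h2 : C * (‖y‖ / (2 * C)) = ‖y‖ / 2 := by field_simp
        linarith
      obtain ⟨e, he, hle⟩ := this
      refine le_add_of_nonneg_of_le (Real.exp_pos _).le (le_trans ?_
        (Finset.single_le_sum (f := fun e => Real.exp ⟪(2 * C * R) • e, y⟫)
          (fun e _ => (Real.exp_pos _).le) he))
      rw [Real.exp_le_exp, real_inner_smul_left]
      rw [div_lt_iff₀ (by positivity)] at hle
      nlinarith
  refine ⟨|B 0| + ∑ e ∈ S, |B ((2 * C * R) • e)|, by positivity, fun t => ?_⟩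
  have hft : Measurable (f t) := hfm.comp (measurable_const.prodMk measurable_id)
  have hi : Integrable (fun y => Real.exp ⟪0, y⟫ * f t y +
      ∑ e ∈ S, Real.exp ⟪(2 * C * R) • e, y⟫ * f t y) :=
    (hA2.integrable 0 t).add (integrable_finsetSum S fun e _ => hA2.integrable _ t)
  have hle : ∀ y, Real.exp (R * ‖y‖) * f t y ≤ Real.exp ⟪0, y⟫ * f t y +
      ∑ e ∈ S, Real.exp ⟪(2 * C * R) • e, y⟫ * f t y := fun y => by
    rw [← Finset.sum_mul, ← add_mul]
    exact mul_le_mul_of_nonneg_right (hpt y) (hf0 t y)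
  have hi' : Integrable (fun y => Real.exp (R * ‖y‖) * f t y) :=
    hi.mono' (by fun_prop) (Eventually.of_forall fun y => by
      rw [Real.norm_of_nonneg (mul_nonneg (Real.exp_pos _).le (hf0 t y))]
      exact hle y)
  refine ⟨hi', (integral_mono hi' hi hle).trans ?_⟩
  rw [integral_add (hA2.integrable 0 t) (integrable_finsetSum S fun e _ => hA2.integrable _ t),
    integral_finsetSum S fun e _ => hA2.integrable _ t]
  exact add_le_add ((hB 0 t).trans (le_abs_self _))
    (Finset.sum_le_sum fun e _ => (hB _ t).trans (le_abs_self _))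

/-- Provides the common dominating function for the later integrals: the y-integral is bounded
uniformly in the base point, and K is integrable in z. -/
lemma CondA2.integrable_kernel_mul_exp_norm (hA2 : CondA2 f x)
    (hfm : Measurable fun p : EuclideanSpace ℝ (Fin d) × EuclideanSpace ℝ (Fin q) => f p.1 p.2)
    (hf0 : ∀ t y, 0 ≤ f t y) (hKm : Measurable K) (hK : Integrable K) {R : ℝ} (hR : 0 ≤ R)
    (h : ℝ) :
    Integrable fun p : EuclideanSpace ℝ (Fin d) × EuclideanSpace ℝ (Fin q) =>
      |K p.1| * (Real.exp (R * ‖p.2‖) * f (x - h • p.1) p.2) := by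
  obtain ⟨M, hM, hb⟩ := hA2.exists_exp_norm_bound hfm hf0 hR
  have hm : Measurable fun p : EuclideanSpace ℝ (Fin d) × EuclideanSpace ℝ (Fin q) =>
      |K p.1| * (Real.exp (R * ‖p.2‖) * f (x - h • p.1) p.2) := by
    have : Measurable fun p : EuclideanSpace ℝ (Fin d) × EuclideanSpace ℝ (Fin q) =>
        f (x - h • p.1) p.2 :=
      hfm.comp ((measurable_const.sub (measurable_fst.const_smul h)).prodMk measurable_snd)
    fun_prop
  rw [Measure.volume_eq_prod, integrable_prod_iff hm.aestronglyMeasurable]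
  refine ⟨Eventually.of_forall fun z => (hb (x - h • z)).1.const_mul |K z|, ?_⟩
  refine (hK.abs.mul_const M).mono' hm.aestronglyMeasurable.norm.integral_prod_right'
    (Eventually.of_forall fun z => ?_)
  have : ∀ y, ‖|K z| * (Real.exp (R * ‖y‖) * f (x - h • z) y)‖ =
      |K z| * (Real.exp (R * ‖y‖) * f (x - h • z) y) := fun y =>
    Real.norm_of_nonneg (mul_nonneg (abs_nonneg _) (mul_nonneg (Real.exp_pos _).le (hf0 _ _)))
  simp only [this]
  rw [integral_const_mul, Real.norm_of_nonneg (mul_nonneg (abs_nonneg _)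
    (integral_nonneg fun y => mul_nonneg (Real.exp_pos _).le (hf0 _ _)))]
  exact mul_le_mul_of_nonneg_left (hb _).2 (abs_nonneg _)

/-- The scaled increment `s⁻¹ ∫ (e^{s (⟨u, y⟩ + v) k} - 1) f(t, y) dy`. -/
noncomputable def increment (f : EuclideanSpace ℝ (Fin d) → EuclideanSpace ℝ (Fin q) → ℝ)
    (u : EuclideanSpace ℝ (Fin q)) (v s : ℝ) (t : EuclideanSpace ℝ (Fin d)) (k : ℝ) : ℝ :=
  ∫ y, s⁻¹ * (Real.exp (s * ((⟪u, y⟫ + v) * k)) - 1) * f t y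

/-- Since f(t, y) need not be continuous in t for fixed y, limits in t are available only through
exponential moments; this form exposes them. -/
lemma CondA2.increment_eq (hA2 : CondA2 f x) (u : EuclideanSpace ℝ (Fin q)) (v s : ℝ)
    (t : EuclideanSpace ℝ (Fin d)) (k : ℝ) :
    increment f u v s t k =
      s⁻¹ * (Real.exp (s * (v * k)) * expMoment f (s • k • u) t - expMoment f 0 t) := by
  have : ∀ y, s⁻¹ * (Real.exp (s * ((⟪u, y⟫ + v) * k)) - 1) * f t y =
      s⁻¹ * (Real.exp (s * (v * k)) * (Real.exp ⟪s • k • u, y⟫ * f t y) -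
        Real.exp ⟪0, y⟫ * f t y) := fun y => by
    rw [real_inner_smul_left, real_inner_smul_left, inner_zero_left, Real.exp_zero, ← mul_assoc
      (Real.exp _), ← Real.exp_add]
    ring_nf
  simp only [increment, this]
  rw [integral_const_mul, integral_sub ((hA2.integrable _ t).const_mul _) (hA2.integrable 0 t),
    integral_const_mul]
  rfl

lemma CondA2.exists_abs_increment_le (hA2 : CondA2 f x)
    (hfm : Measurable fun p : EuclideanSpace ℝ (Fin d) × EuclideanSpace ℝ (Fin q) => f p.1 p.2)
    (hf0 : ∀ t y, 0 ≤ f t y) {C : ℝ} (hC : 0 ≤ C) (u : EuclideanSpace ℝ (Fin q)) (v : ℝ) :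
    ∃ M, 0 ≤ M ∧ ∀ s t k, 0 < s → s ≤ 1 → |k| ≤ C → |increment f u v s t k| ≤ |k| * M := by
  have hC1 : 0 ≤ C + 1 := by linarith
  obtain ⟨M, hM, hb⟩ := hA2.exists_exp_norm_bound hfm hf0 (mul_nonneg hC1 (norm_nonneg u))
  refine ⟨Real.exp ((C + 1) * |v|) * M, by positivity, fun s t k hs hs1 hk => ?_⟩
  have : |increment f u v s t k| ≤ ∫ y, |k| * (Real.exp ((C + 1) * |v|) *
      (Real.exp ((C + 1) * ‖u‖ * ‖y‖) * f t y)) := by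
    rw [← Real.norm_eq_abs, increment]
    refine norm_integral_le_of_norm_le (((hb t).1.const_mul _).const_mul _)
      (Eventually.of_forall fun y => ?_)
    rw [norm_mul, Real.norm_eq_abs, Real.norm_of_nonneg (hf0 t y)]
    calc _ ≤ |k| * (Real.exp ((C + 1) * |v|) * Real.exp ((C + 1) * ‖u‖ * ‖y‖)) * f t y :=
          mul_le_mul_of_nonneg_right ((abs_inv_mul_exp_sub_one_le hs hs1 hk).trans
            (mul_le_mul_of_nonneg_left (exp_mul_abs_inner_add_le u y v hC1) (abs_nonneg k)))
            (hf0 t y)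
      _ = _ := by ring
  rw [integral_const_mul, integral_const_mul] at this
  refine this.trans ?_
  gcongr
  exact (hb t).2

/-- The tilt S n and the base point T n move together. Dominated convergence treats the tilt at the
fixed point x, and the uniformity in α of (A'1), applied with α = S n, treats the change of base
point. -/
lemma CondA2.tendsto_increment (hA2 : CondA2 f x) (hA1' : CondA1' f x)
    (hfm : Measurable fun p : EuclideanSpace ℝ (Fin d) × EuclideanSpace ℝ (Fin q) => f p.1 p.2)
    (hf0 : ∀ t y, 0 ≤ f t y) (u : EuclideanSpace ℝ (Fin q)) (v k : ℝ) {S : ℕ → ℝ} {s : ℝ}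
    {T : ℕ → EuclideanSpace ℝ (Fin d)} (hS : Tendsto S atTop (𝓝 s)) (hs : 0 < s)
    (hS01 : ∀ᶠ n in atTop, S n ∈ Icc (0 : ℝ) 1) (hT : Tendsto T atTop (𝓝 x)) :
    Tendsto (fun n => increment f u v (S n) (T n) k) atTop (𝓝 (increment f u v s x k)) := by
  simp only [hA2.increment_eq]
  have hft : Measurable (f x) := hfm.comp (measurable_const.prodMk measurable_id)
  have h0 : Tendsto (fun n => expMoment f 0 (T n)) atTop (𝓝 (expMoment f 0 x)) :=
    (hA2.continuousAt 0).tendsto.comp hT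
  have h1 : Tendsto (fun n => expMoment f (S n • k • u) x) atTop
      (𝓝 (expMoment f (s • k • u) x)) := by
    obtain ⟨M, hM, hb⟩ := hA2.exists_exp_norm_bound hfm hf0 (norm_nonneg (k • u))
    refine tendsto_integral_filter_of_dominated_convergence _
      (Eventually.of_forall fun n => (hA2.integrable _ x).aestronglyMeasurable) ?_ (hb x).1
      (Eventually.of_forall fun y => ?_)
    · filter_upwards [hS01] with n hn
      refine Eventually.of_forall fun y => ?_
      rw [norm_mul, Real.norm_of_nonneg (Real.exp_pos _).le, Real.norm_of_nonneg (hf0 x y)]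
      refine mul_le_mul_of_nonneg_right (Real.exp_le_exp.2 ?_) (hf0 x y)
      rw [real_inner_smul_left]
      have h2 := real_inner_le_norm (k • u) y
      have h3 : 0 ≤ ‖k • u‖ * ‖y‖ := by positivity
      calc S n * ⟪k • u, y⟫ ≤ S n * (‖k • u‖ * ‖y‖) := mul_le_mul_of_nonneg_left h2 hn.1
        _ ≤ 1 * (‖k • u‖ * ‖y‖) := mul_le_mul_of_nonneg_right hn.2 h3
        _ = _ := one_mul _
    · have : Continuous fun s : ℝ => Real.exp ⟪s • k • u, y⟫ * f x y := by fun_prop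
      exact (this.tendsto s).comp hS
  have h2 : Tendsto (fun n => expMoment f (S n • k • u) (T n) - expMoment f (S n • k • u) x) atTop
      (𝓝 0) := by
    rw [Metric.tendsto_atTop']
    intro ε hε
    obtain ⟨δ, hδ, hu⟩ := hA1' (k • u) ε hε
    obtain ⟨N, hN⟩ := eventually_atTop.1 (hS01.and (hT.eventually (Metric.ball_mem_nhds x hδ)))
    refine ⟨N, fun n hn => ?_⟩
    obtain ⟨ha, hb⟩ := hN n hn.le
    rw [Real.dist_0_eq_abs]
    exact hu _ (mem_ball_iff_norm.1 hb) _ ha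
  have h3 : Tendsto (fun n => expMoment f (S n • k • u) (T n)) atTop
      (𝓝 (expMoment f (s • k • u) x)) := by
    simpa using h2.add h1
  exact (hS.inv₀ hs.ne').mul (((Real.continuous_exp.tendsto _).comp (hS.mul_const _)).mul h3
    |>.sub h0)

lemma CondA2.integrable_increment (hA2 : CondA2 f x)
    (hfm : Measurable fun p : EuclideanSpace ℝ (Fin d) × EuclideanSpace ℝ (Fin q) => f p.1 p.2)
    (hf0 : ∀ t y, 0 ≤ f t y) (hKm : Measurable K) (hK : Integrable K) {C : ℝ} (hC : 0 ≤ C)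
    (hKC : ∀ z, |K z| ≤ C) (u : EuclideanSpace ℝ (Fin q)) (v : ℝ) {s : ℝ} (hs : 0 < s)
    (hs1 : s ≤ 1) (h : ℝ) :
    Integrable fun p : EuclideanSpace ℝ (Fin d) × EuclideanSpace ℝ (Fin q) =>
      s⁻¹ * (Real.exp (s * ((⟪u, p.2⟫ + v) * K p.1)) - 1) * f (x - h • p.1) p.2 := by
  have hC1 : 0 ≤ C + 1 := by linarith
  have hi := (hA2.integrable_kernel_mul_exp_norm hfm hf0 hKm hK
    (mul_nonneg hC1 (norm_nonneg u)) h).const_mul (Real.exp ((C + 1) * |v|))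
  refine hi.mono' (Measurable.aestronglyMeasurable ?_) (Eventually.of_forall fun p => ?_)
  · have : Measurable fun p : EuclideanSpace ℝ (Fin d) × EuclideanSpace ℝ (Fin q) =>
        f (x - h • p.1) p.2 :=
      hfm.comp ((measurable_const.sub (measurable_fst.const_smul h)).prodMk measurable_snd)
    fun_prop
  · rw [norm_mul, Real.norm_eq_abs, Real.norm_of_nonneg (hf0 _ _)]
    calc _ ≤ |K p.1| * (Real.exp ((C + 1) * |v|) * Real.exp ((C + 1) * ‖u‖ * ‖p.2‖)) *
          f (x - h • p.1) p.2 := mul_le_mul_of_nonneg_right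
            ((abs_inv_mul_exp_sub_one_le hs hs1 (hKC _)).trans (mul_le_mul_of_nonneg_left
              (exp_mul_abs_inner_add_le u p.2 v hC1) (abs_nonneg _))) (hf0 _ _)
      _ = _ := by ring

/-- The kernel average of the scaled increment at bandwidth `h`. -/
noncomputable def kernelIncrement (K : EuclideanSpace ℝ (Fin d) → ℝ)
    (f : EuclideanSpace ℝ (Fin d) → EuclideanSpace ℝ (Fin q) → ℝ) (x : EuclideanSpace ℝ (Fin d))
    (u : EuclideanSpace ℝ (Fin q)) (v s h : ℝ) : ℝ :=
  ∫ z, increment f u v s (x - h • z) (K z)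

lemma CondA2.exists_abs_kernelIncrement_le (hA2 : CondA2 f x)
    (hfm : Measurable fun p : EuclideanSpace ℝ (Fin d) × EuclideanSpace ℝ (Fin q) => f p.1 p.2)
    (hf0 : ∀ t y, 0 ≤ f t y) (hK : Integrable K) {C : ℝ} (hC : 0 ≤ C)
    (hKC : ∀ z, |K z| ≤ C) (u : EuclideanSpace ℝ (Fin q)) (v : ℝ) :
    ∃ M, 0 ≤ M ∧ ∀ s h, 0 < s → s ≤ 1 → |kernelIncrement K f x u v s h| ≤ M := by
  obtain ⟨M, hM, hb⟩ := hA2.exists_abs_increment_le hfm hf0 hC u v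
  exact ⟨∫ z, |K z| * M, integral_nonneg fun z => by positivity, fun s h hs hs1 => by
    rw [← Real.norm_eq_abs, kernelIncrement]
    exact norm_integral_le_of_norm_le (hK.abs.mul_const M) (Eventually.of_forall fun z =>
      hb _ _ _ hs hs1 (hKC z))⟩

/-- Dominated convergence in z, with bound a multiple of |K|; bandwidth 0 in the limit means that
the density is frozen at x. -/
lemma CondA2.tendsto_kernelIncrement (hA2 : CondA2 f x) (hA1' : CondA1' f x)
    (hfm : Measurable fun p : EuclideanSpace ℝ (Fin d) × EuclideanSpace ℝ (Fin q) => f p.1 p.2)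
    (hf0 : ∀ t y, 0 ≤ f t y) (hKm : Measurable K) (hK : Integrable K) {C : ℝ} (hC : 0 ≤ C)
    (hKC : ∀ z, |K z| ≤ C) (u : EuclideanSpace ℝ (Fin q)) (v : ℝ) {S H : ℕ → ℝ} {s : ℝ}
    (hS : Tendsto S atTop (𝓝 s)) (hs : 0 < s)
    (hS01 : ∀ᶠ n in atTop, 0 < S n ∧ S n ≤ 1) (hH : Tendsto H atTop (𝓝 0)) :
    Tendsto (fun n => kernelIncrement K f x u v (S n) (H n)) atTop
      (𝓝 (kernelIncrement K f x u v s 0)) := by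
  obtain ⟨M, hM, hb⟩ := hA2.exists_abs_increment_le hfm hf0 hC u v
  refine tendsto_integral_filter_of_dominated_convergence (fun z => |K z| * M) ?_ ?_
    (hK.abs.mul_const M) (Eventually.of_forall fun z => ?_)
  · filter_upwards [hS01] with n hn
    have := hA2.integrable_increment hfm hf0 hKm hK hC hKC u v hn.1 hn.2 (H n)
    exact this.aestronglyMeasurable.integral_prod_right'
  · filter_upwards [hS01] with n hn
    exact Eventually.of_forall fun z => hb _ _ _ hn.1 hn.2 (hKC z)
  · rw [zero_smul, sub_zero]
    refine hA2.tendsto_increment hA1' hfm hf0 u v _ hS hs (hS01.mono fun n hn => ⟨hn.1.le, hn.2⟩) ?_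
    simpa using (hH.smul_const z).const_sub x

end SemiRecursive

/-! ### Law of one summand, Riemann sums, and regularity of Ψ̃. -/

namespace SemiRecursive

open scoped RealInnerProductSpace ENNReal

variable {d q : ℕ} {f : EuclideanSpace ℝ (Fin d) → EuclideanSpace ℝ (Fin q) → ℝ}
  {x : EuclideanSpace ℝ (Fin d)} {K : EuclideanSpace ℝ (Fin d) → ℝ}

lemma map_inv_smul_sub (x : EuclideanSpace ℝ (Fin d)) {h : ℝ} (hh : 0 < h) :
    Measure.map (fun t : EuclideanSpace ℝ (Fin d) => h⁻¹ • (x - t)) volume =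
      ENNReal.ofReal (h ^ d) • volume := by
  have h1 : (fun t : EuclideanSpace ℝ (Fin d) => h⁻¹ • (x - t)) =
      (fun t => h⁻¹ • t) ∘ (fun t => x - t) := rfl
  rw [h1, ← Measure.map_map (by fun_prop) (by fun_prop),
    (Measure.measurePreserving_sub_left volume x).map_eq,
    Measure.map_addHaar_smul _ (inv_ne_zero hh.ne'), finrank_euclideanSpace_fin, inv_pow, inv_inv,
    abs_of_pos (pow_pos hh d)]

section Law

variable {Ω : Type*} [MeasurableSpace Ω] {μ : Measure Ω}
  {X : ℕ → Ω → EuclideanSpace ℝ (Fin d)} {Y : ℕ → Ω → EuclideanSpace ℝ (Fin q)}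

/-- Change of variables `z = (x - X_i) / h` in the law of `(X_i, Y_i)`. -/
lemma IsSample.integral_comp (hs : IsSample μ X Y f) (x : EuclideanSpace ℝ (Fin d)) (i : ℕ)
    {h : ℝ} (hh : 0 < h) {φ : EuclideanSpace ℝ (Fin d) × EuclideanSpace ℝ (Fin q) → ℝ}
    (hφ : Measurable φ) (hi : Integrable fun p => φ p * f (x - h • p.1) p.2) :
    Integrable (fun ω => φ (h⁻¹ • (x - X i ω), Y i ω)) μ ∧
      ∫ ω, φ (h⁻¹ • (x - X i ω), Y i ω) ∂μ = h ^ d * ∫ p, φ p * f (x - h • p.1) p.2 := by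
  set T : EuclideanSpace ℝ (Fin d) × EuclideanSpace ℝ (Fin q) →
    EuclideanSpace ℝ (Fin d) × EuclideanSpace ℝ (Fin q) :=
    Prod.map (fun t => h⁻¹ • (x - t)) id with hT
  have hTm : Measurable T := by fun_prop
  have hP : Measurable fun ω => (X i ω, Y i ω) := (hs.measurable_X i).prodMk (hs.measurable_Y i)
  have hmap : Measure.map T volume = ENNReal.ofReal (h ^ d) •
      (volume : Measure (EuclideanSpace ℝ (Fin d) × EuclideanSpace ℝ (Fin q))) := by
    rw [Measure.volume_eq_prod, hT, ← Measure.map_prod_map _ _ (by fun_prop) measurable_id,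
      map_inv_smul_sub x hh, Measure.map_id, Measure.prod_smul_left]
  -- The integrand against the density is the pull-back by T of the rescaled one, because x - h z
  -- recovers t when z = (x - t)/h.
  have hF : ∀ p, (ENNReal.ofReal (f p.1 p.2)).toReal • φ (T p) =
      (fun p => φ p * f (x - h • p.1) p.2) (T p) := fun p => by
    simp only [hT, Prod.map_fst, Prod.map_snd, id, smul_inv_smul₀ hh.ne', sub_sub_cancel,
      ENNReal.toReal_ofReal (hs.density_nonneg _ _), smul_eq_mul]
    ring
  have hfm : Measurable fun p : EuclideanSpace ℝ (Fin d) × EuclideanSpace ℝ (Fin q) =>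
      ENNReal.ofReal (f p.1 p.2) := hs.measurable_density.ennreal_ofReal
  have hFm : AEStronglyMeasurable (fun p => φ p * f (x - h • p.1) p.2) (Measure.map T volume) := by
    rw [hmap]
    exact hi.aestronglyMeasurable.smul_measure _
  constructor
  · have h1 : Integrable (fun p => φ (T p)) (μ.map fun ω => (X i ω, Y i ω)) := by
      rw [hs.law i, integrable_withDensity_iff_integrable_smul' hfm
        (Eventually.of_forall fun p => ENNReal.ofReal_lt_top)]
      simp only [hF]
      refine (integrable_map_measure hFm hTm.aemeasurable).1 ?_
      rw [hmap]
      exact hi.smul_measure ENNReal.ofReal_ne_top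
    exact (integrable_map_measure (hφ.comp hTm).aestronglyMeasurable hP.aemeasurable).1 h1
  · calc ∫ ω, φ (h⁻¹ • (x - X i ω), Y i ω) ∂μ
        = ∫ p, φ (T p) ∂(μ.map fun ω => (X i ω, Y i ω)) :=
          (integral_map hP.aemeasurable (hφ.comp hTm).aestronglyMeasurable).symm
      _ = ∫ p, (fun p => φ p * f (x - h • p.1) p.2) (T p) := by
          rw [hs.law i, integral_withDensity_eq_integral_toReal_smul hfm
            (Eventually.of_forall fun p => ENNReal.ofReal_lt_top)]
          simp only [hF]
      _ = ∫ p, φ p * f (x - h • p.1) p.2 ∂(Measure.map T volume) :=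
          (integral_map hTm.aemeasurable hFm).symm
      _ = _ := by
          rw [hmap, integral_smul_measure, ENNReal.toReal_ofReal (by positivity), smul_eq_mul]

/-- Exponential moments of one term of the estimators. -/
lemma IsSample.integral_exp [IsProbabilityMeasure μ] (hs : IsSample μ X Y f) (hA2 : CondA2 f x)
    (hKm : Measurable K) (hK : Integrable K) {C : ℝ} (hC : 0 ≤ C) (hKC : ∀ z, |K z| ≤ C)
    (u : EuclideanSpace ℝ (Fin q)) (v : ℝ) {s h : ℝ} (hs0 : 0 < s) (hs1 : s ≤ 1) (hh : 0 < h)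
    (i : ℕ) :
    Integrable (fun ω => Real.exp (s * ((⟪u, Y i ω⟫ + v) * K (h⁻¹ • (x - X i ω))))) μ ∧
      ∫ ω, Real.exp (s * ((⟪u, Y i ω⟫ + v) * K (h⁻¹ • (x - X i ω)))) ∂μ =
        1 + s * h ^ d * kernelIncrement K f x u v s h := by
  have hi := hA2.integrable_increment hs.measurable_density hs.density_nonneg hKm hK hC hKC u v
    hs0 hs1 h
  obtain ⟨h1, h2⟩ := hs.integral_comp x i hh
    (φ := fun p => s⁻¹ * (Real.exp (s * ((⟪u, p.2⟫ + v) * K p.1)) - 1)) (by fun_prop) hi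
  have he : ∀ ω, Real.exp (s * ((⟪u, Y i ω⟫ + v) * K (h⁻¹ • (x - X i ω)))) =
      1 + s * (s⁻¹ * (Real.exp (s * ((⟪u, Y i ω⟫ + v) * K (h⁻¹ • (x - X i ω)))) - 1)) := fun ω => by
    rw [mul_inv_cancel_left₀ hs0.ne']; ring
  have h3 : ∫ p : EuclideanSpace ℝ (Fin d) × EuclideanSpace ℝ (Fin q),
      s⁻¹ * (Real.exp (s * ((⟪u, p.2⟫ + v) * K p.1)) - 1) * f (x - h • p.1) p.2 =
      kernelIncrement K f x u v s h := by
    rw [Measure.volume_eq_prod] at hi ⊢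
    rw [integral_prod _ hi]
    rfl
  rw [funext he]
  refine ⟨(integrable_const _).add (h1.const_mul s), ?_⟩
  rw [integral_add (integrable_const _) (h1.const_mul s), integral_const_mul, h2, h3]
  simp [mul_assoc]

end Law

/-- The integrand is a step function, constant on each interval (k/n, (k+1)/n]; the ceiling matches
indices running from 1 to n. Convergence of means thus becomes dominated convergence on [0, 1]. -/
lemma average_eq_integral_ceil (g : ℕ → ℝ) {n : ℕ} (hn : 0 < n) :
    1 / (n : ℝ) * ∑ i ∈ Finset.Icc 1 n, g i = ∫ σ in (0 : ℝ)..1, g ⌈(n : ℝ) * σ⌉₊ := by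
  have hn' : (n : ℝ) ≠ 0 := by positivity
  have hc : ∀ k : ℕ, EqOn (fun _ => g (k + 1)) (fun t : ℝ => g ⌈t⌉₊)
      (uIoc (k : ℝ) ((k + 1 : ℕ) : ℝ)) := fun k t ht => by
    rw [uIoc_of_le (by push_cast; linarith)] at ht
    have : ⌈t⌉₊ = k + 1 := by
      rw [Nat.ceil_eq_iff (by omega)]
      simpa using ht
    simp only [this]
  have hsum := intervalIntegral.sum_integral_adjacent_intervals (μ := volume)
    (f := fun t : ℝ => g ⌈t⌉₊) (a := fun k : ℕ => (k : ℝ)) (n := n)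
    (fun k _ => (intervalIntegrable_const (c := g (k + 1))).congr (hc k))
  have hk : ∀ k : ℕ, ∫ t in (k : ℝ)..((k + 1 : ℕ) : ℝ), g ⌈t⌉₊ = g (k + 1) := fun k => by
    rw [← intervalIntegral.integral_congr_ae (Eventually.of_forall fun t ht => hc k ht)]
    simp
  rw [intervalIntegral.integral_comp_mul_left (fun t => g ⌈t⌉₊) hn', mul_zero, mul_one]
  simp only [hk, Nat.cast_zero] at hsum
  rw [← hsum, smul_eq_mul, one_div, Finset.range_eq_Ico, Finset.sum_Ico_add' g 0 n 1]
  rfl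

lemma abs_log_one_add_le {t : ℝ} (ht : |t| ≤ 1 / 2) : |Real.log (1 + t)| ≤ 2 * |t| := by
  obtain ⟨h1, h2⟩ := abs_le.1 ht
  have h3 : 0 < 1 + t := by linarith
  have h4 := Real.log_le_sub_one_of_pos h3
  have h5 := Real.one_sub_inv_le_log_of_pos h3
  have h6 : -(2 * |t|) ≤ 1 - (1 + t)⁻¹ := by
    have : 1 - (1 + t)⁻¹ = t / (1 + t) := by field_simp; ring
    rw [this, le_div_iff₀ h3]
    nlinarith [neg_abs_le t, abs_nonneg t]
  exact abs_le.2 ⟨by linarith, by linarith [le_abs_self t, abs_nonneg t]⟩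

/-- Squeeze: b/(1 + ηb) ≤ η⁻¹ log(1 + ηb) ≤ b. -/
lemma tendsto_inv_mul_log_one_add {η b : ℕ → ℝ} {β : ℝ} (hη : Tendsto η atTop (𝓝 0))
    (hη0 : ∀ᶠ n in atTop, 0 < η n) (hb : Tendsto b atTop (𝓝 β)) :
    Tendsto (fun n => (η n)⁻¹ * Real.log (1 + η n * b n)) atTop (𝓝 β) := by
  have h0 : Tendsto (fun n => 1 + η n * b n) atTop (𝓝 1) := by
    simpa using (hη.mul hb).const_add 1
  have hlow : Tendsto (fun n => b n / (1 + η n * b n)) atTop (𝓝 β) := by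
    have := hb.div h0 one_ne_zero
    rwa [div_one] at this
  refine tendsto_of_tendsto_of_tendsto_of_le_of_le' hlow hb ?_ ?_
  all_goals
    filter_upwards [hη0, h0.eventually_const_lt zero_lt_one] with n hn h1
  · rw [← div_eq_inv_mul, le_div_iff₀ hn]
    refine le_trans (le_of_eq ?_) (Real.one_sub_inv_le_log_of_pos h1)
    rw [div_mul_eq_mul_div, div_eq_iff h1.ne', sub_mul, inv_mul_cancel₀ h1.ne']
    ring
  · rw [inv_mul_le_iff₀ hn]
    linarith [Real.log_le_sub_one_of_pos h1]

section Psi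

/-- Integrability of the integrand of `PsiTilde`. -/
lemma CondA2.integrable_psi (hA2 : CondA2 f x)
    (hfm : Measurable fun p : EuclideanSpace ℝ (Fin d) × EuclideanSpace ℝ (Fin q) => f p.1 p.2)
    (hf0 : ∀ t y, 0 ≤ f t y) (hKm : Measurable K) (hK : Integrable K) {C : ℝ} (hC : 0 ≤ C)
    (hKC : ∀ z, |K z| ≤ C) {a : ℝ} (ha : 0 < a) (u : EuclideanSpace ℝ (Fin q)) (v : ℝ) :
    Integrable (fun p : ℝ × EuclideanSpace ℝ (Fin d) × EuclideanSpace ℝ (Fin q) =>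
      p.1 ^ (-(a * d)) * (Real.exp (p.1 ^ (a * d) * ((inner ℝ u p.2.2 + v) * K p.2.1)) - 1) *
        f x p.2.2) ((volume.restrict (Ioc (0 : ℝ) 1)).prod volume) := by
  have hC1 : 0 ≤ C + 1 := by linarith
  have hi := ((hA2.integrable_kernel_mul_exp_norm hfm hf0 hKm hK
    (mul_nonneg hC1 (norm_nonneg u)) 0).const_mul (Real.exp ((C + 1) * |v|))).comp_snd
      (volume.restrict (Ioc (0 : ℝ) 1))
  have hfx : Measurable (f x) := hfm.comp (measurable_const.prodMk measurable_id)
  have hIoc : ∀ᵐ p : ℝ × EuclideanSpace ℝ (Fin d) × EuclideanSpace ℝ (Fin q)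
      ∂((volume.restrict (Ioc (0 : ℝ) 1)).prod volume), p.1 ∈ Ioc (0 : ℝ) 1 :=
    Measure.quasiMeasurePreserving_fst.ae (ae_restrict_mem measurableSet_Ioc)
  refine hi.mono' (Measurable.aestronglyMeasurable (by fun_prop)) ?_
  filter_upwards [hIoc] with p hp
  have hs : 0 < p.1 ^ (a * d) := Real.rpow_pos_of_pos hp.1 _
  have hs1 : p.1 ^ (a * d) ≤ 1 := Real.rpow_le_one hp.1.le hp.2 (by positivity)
  rw [Real.rpow_neg hp.1.le, norm_mul, Real.norm_eq_abs, Real.norm_of_nonneg (hf0 _ _), zero_smul,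
    sub_zero]
  calc _ ≤ |K p.2.1| * (Real.exp ((C + 1) * |v|) * Real.exp ((C + 1) * ‖u‖ * ‖p.2.2‖)) *
        f x p.2.2 := mul_le_mul_of_nonneg_right
          ((abs_inv_mul_exp_sub_one_le hs hs1 (hKC _)).trans (mul_le_mul_of_nonneg_left
            (exp_mul_abs_inner_add_le u p.2.2 v hC1) (abs_nonneg _))) (hf0 _ _)
    _ = _ := by ring

lemma CondA2.psiTilde_eq (hA2 : CondA2 f x)
    (hfm : Measurable fun p : EuclideanSpace ℝ (Fin d) × EuclideanSpace ℝ (Fin q) => f p.1 p.2)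
    (hf0 : ∀ t y, 0 ≤ f t y) (hKm : Measurable K) (hK : Integrable K) {C : ℝ} (hC : 0 ≤ C)
    (hKC : ∀ z, |K z| ≤ C) {a : ℝ} (ha : 0 < a) (u : EuclideanSpace ℝ (Fin q)) (v : ℝ) :
    PsiTilde K f a x u v = ∫ σ in (0 : ℝ)..1, kernelIncrement K f x u v (σ ^ (a * d)) 0 := by
  -- The null point σ = 0 is removed, since the estimates on the integrand need σ^{ad} > 0.
  rw [PsiTilde, Measure.restrict_congr_set Ioc_ae_eq_Icc.symm,
    integral_prod _ (hA2.integrable_psi hfm hf0 hKm hK hC hKC ha u v),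
    intervalIntegral.integral_of_le zero_le_one]
  refine setIntegral_congr_fun measurableSet_Ioc fun σ hσ => ?_
  have hs : 0 < σ ^ (a * d) := Real.rpow_pos_of_pos hσ.1 _
  have hs1 : σ ^ (a * d) ≤ 1 := Real.rpow_le_one hσ.1.le hσ.2 (by positivity)
  have hi := hA2.integrable_increment hfm hf0 hKm hK hC hKC u v hs hs1 0
  simp only [zero_smul, sub_zero] at hi
  simp only [kernelIncrement, zero_smul, sub_zero, Real.rpow_neg hσ.1.le]
  rw [Measure.volume_eq_prod] at hi ⊢
  rw [integral_prod _ hi]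
  rfl

/-- Makes ⟨u, y⟩ + v linear in l = (u, v), with gradient (y, 1). -/
lemma inner_toLp_one (y : EuclideanSpace ℝ (Fin q)) (l : WithLp 2 (EuclideanSpace ℝ (Fin q) × ℝ)) :
    ⟪WithLp.toLp 2 (y, (1 : ℝ)), l⟫ = ⟪l.fst, y⟫ + l.snd := by
  rw [WithLp.prod_inner_apply, real_inner_comm]
  simp

lemma norm_toLp_one_le (y : EuclideanSpace ℝ (Fin q)) :
    ‖WithLp.toLp 2 (y, (1 : ℝ))‖ ≤ ‖y‖ + 1 := by
  have h : ‖WithLp.toLp 2 (y, (1 : ℝ))‖ ^ 2 = ‖y‖ ^ 2 + ‖(1 : ℝ)‖ ^ 2 :=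
    WithLp.prod_norm_sq_eq_of_L2 _
  rw [norm_one] at h
  refine le_of_sq_le_sq ?_ (by positivity)
  nlinarith [norm_nonneg y]

/-- Differentiation under the integral sign: the chain rule produces a factor σ^{ad} that cancels
the singular prefactor. -/
lemma CondA2.differentiable_psiTilde (hA2 : CondA2 f x)
    (hfm : Measurable fun p : EuclideanSpace ℝ (Fin d) × EuclideanSpace ℝ (Fin q) => f p.1 p.2)
    (hf0 : ∀ t y, 0 ≤ f t y) (hKm : Measurable K) (hK : Integrable K) {C : ℝ} (hC : 0 ≤ C)
    (hKC : ∀ z, |K z| ≤ C) {a : ℝ} (ha : 0 < a) :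
    Differentiable ℝ fun l : WithLp 2 (EuclideanSpace ℝ (Fin q) × ℝ) =>
      PsiTilde K f a x l.fst l.snd := by
  intro l₀
  have hfx : Measurable (f x) := hfm.comp (measurable_const.prodMk measurable_id)
  -- C(‖l₀‖ + 1) bounds the exponent for l in the unit ball around l₀; the last 1 absorbs the norm η
  -- of (y, 1) through η ≤ e^η.
  set R : ℝ := C * (‖l₀‖ + 1) + 1 with hR
  have hR0 : 0 ≤ R := by positivity
  have hi := ((hA2.integrable_kernel_mul_exp_norm hfm hf0 hKm hK hR0 0).const_mul
    (Real.exp R)).comp_snd (volume.restrict (Ioc (0 : ℝ) 1))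
  have hIoc : ∀ᵐ p : ℝ × EuclideanSpace ℝ (Fin d) × EuclideanSpace ℝ (Fin q)
      ∂((volume.restrict (Ioc (0 : ℝ) 1)).prod volume), p.1 ∈ Ioc (0 : ℝ) 1 :=
    Measure.quasiMeasurePreserving_fst.ae (ae_restrict_mem measurableSet_Ioc)
  let F' : WithLp 2 (EuclideanSpace ℝ (Fin q) × ℝ) →
      ℝ × EuclideanSpace ℝ (Fin d) × EuclideanSpace ℝ (Fin q) →
      WithLp 2 (EuclideanSpace ℝ (Fin q) × ℝ) →L[ℝ] ℝ := fun l p =>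
    (Real.exp (p.1 ^ (a * d) * ((⟪l.fst, p.2.2⟫ + l.snd) * K p.2.1)) * K p.2.1 * f x p.2.2) •
      innerSL ℝ (WithLp.toLp 2 (p.2.2, (1 : ℝ)))
  have key := hasFDerivAt_integral_of_dominated_of_fderiv_le
    (μ := (volume.restrict (Ioc (0 : ℝ) 1)).prod
      (volume : Measure (EuclideanSpace ℝ (Fin d) × EuclideanSpace ℝ (Fin q))))
    (F := fun (l : WithLp 2 (EuclideanSpace ℝ (Fin q) × ℝ)) p =>
      p.1 ^ (-(a * d)) * (Real.exp (p.1 ^ (a * d) * ((⟪l.fst, p.2.2⟫ + l.snd) * K p.2.1)) - 1) *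
        f x p.2.2) (F' := F') (x₀ := l₀) (𝕜 := ℝ)
    (Metric.ball_mem_nhds l₀ one_pos)
    (Eventually.of_forall fun l =>
      (hA2.integrable_psi hfm hf0 hKm hK hC hKC ha l.fst l.snd).aestronglyMeasurable)
    (hA2.integrable_psi hfm hf0 hKm hK hC hKC ha l₀.fst l₀.snd)
    ?_ ?_ hi ?_
  · simp only [PsiTilde]
    rw [Measure.restrict_congr_set Ioc_ae_eq_Icc.symm]
    exact key.differentiableAt
  · have hm : Measurable fun p : ℝ × EuclideanSpace ℝ (Fin d) × EuclideanSpace ℝ (Fin q) =>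
        Real.exp (p.1 ^ (a * d) * ((⟪l₀.fst, p.2.2⟫ + l₀.snd) * K p.2.1)) * K p.2.1 *
          f x p.2.2 := by
      fun_prop
    refine hm.aestronglyMeasurable.smul (Continuous.aestronglyMeasurable ?_)
    fun_prop
  · filter_upwards [hIoc] with p hp l hl
    have hs : 0 < p.1 ^ (a * d) := Real.rpow_pos_of_pos hp.1 _
    have hs1 : p.1 ^ (a * d) ≤ 1 := Real.rpow_le_one hp.1.le hp.2 (by positivity)
    have hl1 : ‖l‖ ≤ ‖l₀‖ + 1 := by
      have := norm_le_norm_add_norm_sub' l l₀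
      rw [mem_ball_iff_norm] at hl
      linarith
    set η := ‖WithLp.toLp 2 (p.2.2, (1 : ℝ))‖ with hη
    have hη0 : 0 ≤ η := norm_nonneg _
    have he : p.1 ^ (a * d) * ((⟪l.fst, p.2.2⟫ + l.snd) * K p.2.1) ≤ (R - 1) * η := by
      refine (le_abs_self _).trans ?_
      rw [← inner_toLp_one, abs_mul, abs_mul, abs_of_pos hs]
      calc _ ≤ 1 * (η * (‖l₀‖ + 1) * C) := by
            gcongr
            · exact (abs_real_inner_le_norm _ _).trans (by gcongr)
            · exact hKC _
        _ = (R - 1) * η := by rw [hR]; ring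
    rw [norm_smul, innerSL_apply_norm, norm_mul, norm_mul, Real.norm_of_nonneg (Real.exp_pos _).le,
      Real.norm_eq_abs, Real.norm_of_nonneg (hf0 _ _), zero_smul, sub_zero, ← hη]
    calc _ ≤ Real.exp ((R - 1) * η) * |K p.2.1| * f x p.2.2 * Real.exp η := by
          have h1 := Real.exp_le_exp.2 he
          have h2 : η ≤ Real.exp η := by linarith [Real.add_one_le_exp η]
          have h3 := hf0 x p.2.2
          gcongr
      _ = |K p.2.1| * (Real.exp (R * η) * f x p.2.2) := by
          have : R * η = (R - 1) * η + η := by ring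
          rw [this, Real.exp_add]; ring
      _ ≤ |K p.2.1| * (Real.exp (R * (‖p.2.2‖ + 1)) * f x p.2.2) := by
          have h1 := norm_toLp_one_le p.2.2
          have h3 := hf0 x p.2.2
          gcongr
      _ = _ := by rw [mul_add, mul_one, Real.exp_add]; ring
  · filter_upwards [hIoc] with p hp l _
    have hs : 0 < p.1 ^ (a * d) := Real.rpow_pos_of_pos hp.1 _
    simp only [← inner_toLp_one, F', Real.rpow_neg hp.1.le]
    have h1 : HasFDerivAt (fun l => ⟪WithLp.toLp 2 (p.2.2, (1 : ℝ)), l⟫)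
        (innerSL ℝ (WithLp.toLp 2 (p.2.2, (1 : ℝ)))) l :=
      (innerSL ℝ (WithLp.toLp 2 (p.2.2, (1 : ℝ)))).hasFDerivAt
    have h2 := (((((h1.mul_const (K p.2.1)).const_mul (p.1 ^ (a * d))).exp.sub_const 1).const_mul
      ((p.1 ^ (a * d))⁻¹)).mul_const (f x p.2.2))
    refine h2.congr_fderiv ?_
    simp only [smul_smul]
    congr 1
    field_simp

end Psi

end SemiRecursive

/-! ### Limiting cgf of the pair (m̃_n, g̃_n). -/

namespace SemiRecursive

open scoped RealInnerProductSpace ENNReal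

variable {d q : ℕ} {f : EuclideanSpace ℝ (Fin d) → EuclideanSpace ℝ (Fin q) → ℝ}
  {x : EuclideanSpace ℝ (Fin d)} {K : EuclideanSpace ℝ (Fin d) → ℝ}
  {Ω : Type*} [MeasurableSpace Ω] {μ : Measure Ω}
  {X : ℕ → Ω → EuclideanSpace ℝ (Fin d)} {Y : ℕ → Ω → EuclideanSpace ℝ (Fin q)} {a c : ℝ}

lemma bandwidth_pos (hc : 0 < c) {n : ℕ} (hn : 0 < n) : 0 < bandwidth c a n :=
  mul_pos hc (Real.rpow_pos_of_pos (by positivity) _)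

/-- This scaling identity is the source of the weight σ^{ad} in Ψ̃, with σ = i/n. -/
lemma bandwidth_pow_eq (hc : 0 < c) {i n : ℕ} (hi : 0 < i) (hn : 0 < n) :
    bandwidth c a n ^ d = ((i : ℝ) / n) ^ (a * d) * bandwidth c a i ^ d := by
  have hi' : (0 : ℝ) < i := by positivity
  have hn' : (0 : ℝ) < n := by positivity
  have h1 : bandwidth c a n = ((i : ℝ) / n) ^ a * bandwidth c a i := by
    have h2 : ((i : ℝ) ^ a) ≠ 0 := (Real.rpow_pos_of_pos hi' a).ne'
    have h3 : ((n : ℝ) ^ a) ≠ 0 := (Real.rpow_pos_of_pos hn' a).ne'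
    rw [bandwidth, bandwidth, Real.div_rpow hi'.le hn'.le, Real.rpow_neg hn'.le,
      Real.rpow_neg hi'.le]
    field_simp
  rw [h1, mul_pow, Real.rpow_mul_natCast (by positivity)]

lemma tendsto_bandwidth (ha : 0 < a) : Tendsto (bandwidth c a) atTop (𝓝 0) := by
  have := ((tendsto_rpow_neg_atTop ha).comp tendsto_natCast_atTop_atTop).const_mul c
  rwa [mul_zero] at this

lemma tendsto_mul_bandwidth_pow (hd : 0 < d) (hc : 0 < c) (had : a < 1 / (d : ℝ)) :
    Tendsto (fun n : ℕ => (n : ℝ) * bandwidth c a n ^ d) atTop atTop := by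
  have had' : 0 < 1 - a * d := by
    rw [lt_div_iff₀ (by positivity)] at had
    linarith
  have h1 := ((tendsto_rpow_atTop had').comp tendsto_natCast_atTop_atTop).const_mul_atTop
    (pow_pos hc d)
  refine h1.congr' ?_
  filter_upwards [eventually_gt_atTop 0] with n hn
  have hn' : (0 : ℝ) < n := by positivity
  simp only [Function.comp]
  rw [bandwidth, mul_pow, ← Real.rpow_mul_natCast hn'.le, sub_eq_add_neg, Real.rpow_add hn',
    Real.rpow_one, neg_mul]
  ring

/-- The pair `(m̃_n(x), g̃_n(x))` as a vector of the Hilbert space `ℝ^q × ℝ`. -/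
noncomputable def pairTilde (K : EuclideanSpace ℝ (Fin d) → ℝ) (h : ℕ → ℝ)
    (X : ℕ → Ω → EuclideanSpace ℝ (Fin d)) (Y : ℕ → Ω → EuclideanSpace ℝ (Fin q))
    (x : EuclideanSpace ℝ (Fin d)) (n : ℕ) (ω : Ω) : WithLp 2 (EuclideanSpace ℝ (Fin q) × ℝ) :=
  WithLp.toLp 2 (mTilde K h X Y x n ω, gTilde K h X x n ω)

omit [MeasurableSpace Ω] in
lemma inner_pairTilde (h : ℕ → ℝ) (l : WithLp 2 (EuclideanSpace ℝ (Fin q) × ℝ)) (n : ℕ) (ω : Ω) :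
    ⟪l, pairTilde K h X Y x n ω⟫ = 1 / (n : ℝ) * ∑ i ∈ Finset.Icc 1 n,
      1 / h i ^ d * ((⟪l.fst, Y i ω⟫ + l.snd) * K ((h i)⁻¹ • (x - X i ω))) := by
  rw [pairTilde, WithLp.prod_inner_apply]
  simp only [mTilde, gTilde, real_inner_smul_right, inner_sum, Real.inner_apply]
  rw [mul_left_comm _ (1 / (n : ℝ)), ← mul_add, Finset.mul_sum, ← Finset.sum_add_distrib]
  congr 1
  refine Finset.sum_congr rfl fun i _ => ?_
  change _ * ⟪l.fst, Y i ω⟫ + l.snd * _ = _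
  ring

lemma measurable_inner_pairTilde (hs : IsSample μ X Y f) (hKm : Measurable K) (h : ℕ → ℝ)
    (l : WithLp 2 (EuclideanSpace ℝ (Fin q) × ℝ)) (n : ℕ) :
    Measurable fun ω => ⟪l, pairTilde K h X Y x n ω⟫ := by
  simp only [inner_pairTilde]
  have hX := hs.measurable_X
  have hY := hs.measurable_Y
  fun_prop

/-- The exponential moments of the pair `(m̃_n(x), g̃_n(x))` at speed `n h_n^d`. -/
lemma IsSample.cgf_pairTilde [IsProbabilityMeasure μ] (hs : IsSample μ X Y f) (hA2 : CondA2 f x)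
    (hKm : Measurable K) (hK : Integrable K) {C : ℝ} (hC : 0 ≤ C) (hKC : ∀ z, |K z| ≤ C)
    (hc : 0 < c) (ha : 0 < a) (l : WithLp 2 (EuclideanSpace ℝ (Fin q) × ℝ)) {n : ℕ}
    (hn : 0 < n) :
    Integrable (fun ω => Real.exp ((n : ℝ) * bandwidth c a n ^ d *
      ⟪l, pairTilde K (bandwidth c a) X Y x n ω⟫)) μ ∧
    cgf (fun ω => ⟪l, pairTilde K (bandwidth c a) X Y x n ω⟫) μ
        ((n : ℝ) * bandwidth c a n ^ d) =
      ∑ i ∈ Finset.Icc 1 n, Real.log (1 + bandwidth c a n ^ d *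
        kernelIncrement K f x l.fst l.snd (((i : ℝ) / n) ^ (a * d)) (bandwidth c a i)) := by
  have hn' : (0 : ℝ) < n := by positivity
  -- The speed is absorbed into the summands, n h_n^d · (1/n) · h_i^{-d} = (i/n)^{ad}, so the cgf of
  -- the sum is taken at 1.
  let W : ℕ → Ω → ℝ := fun i ω => ((i : ℝ) / n) ^ (a * d) *
    ((⟪l.fst, Y i ω⟫ + l.snd) * K ((bandwidth c a i)⁻¹ • (x - X i ω)))
  have hWm : ∀ i, Measurable (W i) := fun i => by
    have hX := hs.measurable_X i
    have hY := hs.measurable_Y i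
    fun_prop
  have hWind : iIndepFun W μ := hs.indep.comp
    (fun i (p : EuclideanSpace ℝ (Fin d) × EuclideanSpace ℝ (Fin q)) => ((i : ℝ) / n) ^ (a * d) *
      ((⟪l.fst, p.2⟫ + l.snd) * K ((bandwidth c a i)⁻¹ • (x - p.1)))) fun i => by fun_prop
  have hsum : ∀ ω, (n : ℝ) * bandwidth c a n ^ d *
      ⟪l, pairTilde K (bandwidth c a) X Y x n ω⟫ = 1 * (∑ i ∈ Finset.Icc 1 n, W i) ω := fun ω => by
    rw [inner_pairTilde, one_mul, Finset.sum_apply]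
    have : (n : ℝ) * bandwidth c a n ^ d * (1 / n * ∑ i ∈ Finset.Icc 1 n,
        1 / bandwidth c a i ^ d * ((⟪l.fst, Y i ω⟫ + l.snd) *
          K ((bandwidth c a i)⁻¹ • (x - X i ω)))) = bandwidth c a n ^ d * ∑ i ∈ Finset.Icc 1 n,
        1 / bandwidth c a i ^ d * ((⟪l.fst, Y i ω⟫ + l.snd) *
          K ((bandwidth c a i)⁻¹ • (x - X i ω))) := by
      field_simp
    rw [this, Finset.mul_sum]
    refine Finset.sum_congr rfl fun i hi => ?_
    have hi0 : 0 < i := (Finset.mem_Icc.1 hi).1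
    have hb : bandwidth c a i ^ d ≠ 0 := (pow_pos (bandwidth_pos hc hi0) d).ne'
    rw [bandwidth_pow_eq hc hi0 hn]
    simp only [W]
    field_simp
  have hW : ∀ i ∈ Finset.Icc 1 n, Integrable (fun ω => Real.exp (1 * W i ω)) μ ∧
      mgf (W i) μ 1 = 1 + bandwidth c a n ^ d *
        kernelIncrement K f x l.fst l.snd (((i : ℝ) / n) ^ (a * d)) (bandwidth c a i) :=
    fun i hi => by
      obtain ⟨hi1, hin⟩ := Finset.mem_Icc.1 hi
      have hi0 : (0 : ℝ) < i := by exact_mod_cast hi1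
      have hs0 : 0 < ((i : ℝ) / n) ^ (a * d) := Real.rpow_pos_of_pos (by positivity) _
      have hs1 : ((i : ℝ) / n) ^ (a * d) ≤ 1 := Real.rpow_le_one (by positivity)
        ((div_le_one hn').2 (by exact_mod_cast hin)) (by positivity)
      have := hs.integral_exp hA2 hKm hK hC hKC l.fst l.snd hs0 hs1 (bandwidth_pos (a := a) hc hi1) i
      rw [bandwidth_pow_eq hc hi1 hn]
      simpa only [mgf, one_mul, W] using this
  constructor
  · simp only [hsum]
    exact hWind.integrable_exp_mul_sum hWm fun i hi => (hW i hi).1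
  · have hmgf : mgf (fun ω => ⟪l, pairTilde K (bandwidth c a) X Y x n ω⟫) μ
        ((n : ℝ) * bandwidth c a n ^ d) = mgf (∑ i ∈ Finset.Icc 1 n, W i) μ 1 := by
      simp only [mgf, hsum]
    rw [cgf, hmgf, hWind.mgf_sum hWm, Real.log_prod fun i hi => (mgf_pos (hW i hi).1).ne']
    exact Finset.sum_congr rfl fun i hi => by rw [(hW i hi).2]

/-- The scaled cumulant generating functions of `(m̃_n(x), g̃_n(x))` converge to `Ψ̃`. -/
theorem IsSample.hasLimitingCgf [IsProbabilityMeasure μ] (hs : IsSample μ X Y f) (hd : 0 < d)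
    (hc : 0 < c) (ha : 0 < a) (had : a < 1 / (d : ℝ)) (hA2 : CondA2 f x) (hA1' : CondA1' f x)
    (hKm : Measurable K) (hK : Integrable K) {C : ℝ} (hC : 0 ≤ C) (hKC : ∀ z, |K z| ≤ C) :
    LargeDeviations.HasLimitingCgf μ (fun n => (n : ℝ) * bandwidth c a n ^ d)
      (pairTilde K (bandwidth c a) X Y x)
      (fun l : WithLp 2 (EuclideanSpace ℝ (Fin q) × ℝ) => PsiTilde K f a x l.fst l.snd) where
  speed := tendsto_mul_bandwidth_pow hd hc had
  measurable n l := measurable_inner_pairTilde hs hKm _ l n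
  integrable n l := by
    -- At n = 0 the speed vanishes and the exponential is constant.
    rcases Nat.eq_zero_or_pos n with rfl | hn
    · simp
    · exact (hs.cgf_pairTilde hA2 hKm hK hC hKC hc ha l hn).1
  tendsto l := by
    obtain ⟨M, hM, hb⟩ := hA2.exists_abs_kernelIncrement_le hs.measurable_density
      hs.density_nonneg hK hC hKC l.fst l.snd
    set b : ℕ → ℕ → ℝ := fun n i =>
      kernelIncrement K f x l.fst l.snd (((i : ℝ) / n) ^ (a * d)) (bandwidth c a i) with hbdef
    set η : ℕ → ℝ := fun n => bandwidth c a n ^ d with hηdef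
    have hη : Tendsto η atTop (𝓝 0) := by
      simpa [hd.ne'] using (tendsto_bandwidth (c := c) ha).pow d
    have hη0 : ∀ᶠ n in atTop, 0 < η n := by
      filter_upwards [eventually_gt_atTop 0] with n hn
      exact pow_pos (bandwidth_pos hc hn) d
    rw [hA2.psiTilde_eq hs.measurable_density hs.density_nonneg hKm hK hC hKC ha]
    have heq : ∀ᶠ n in atTop, ∫ σ in (0 : ℝ)..1,
        (η n)⁻¹ * Real.log (1 + η n * b n ⌈(n : ℝ) * σ⌉₊) = ((n : ℝ) * bandwidth c a n ^ d)⁻¹ *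
        cgf (fun ω => ⟪l, pairTilde K (bandwidth c a) X Y x n ω⟫) μ
          ((n : ℝ) * bandwidth c a n ^ d) := by
      filter_upwards [eventually_gt_atTop 0] with n hn
      rw [(hs.cgf_pairTilde hA2 hKm hK hC hKC hc ha l hn).2,
        ← average_eq_integral_ceil (fun i => (η n)⁻¹ * Real.log (1 + η n * b n i)) hn,
        ← Finset.mul_sum, mul_inv, one_div, mul_assoc]
    refine Tendsto.congr' heq ?_
    have hceil : ∀ σ ∈ Ioc (0 : ℝ) 1, ∀ n : ℕ, 0 < n →
        0 < ((⌈(n : ℝ) * σ⌉₊ : ℝ) / n) ^ (a * d) ∧ ((⌈(n : ℝ) * σ⌉₊ : ℝ) / n) ^ (a * d) ≤ 1 :=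
      fun σ hσ n hn => by
        have hn' : (0 : ℝ) < n := by positivity
        have h1 : 0 < ⌈(n : ℝ) * σ⌉₊ := Nat.ceil_pos.2 (mul_pos hn' hσ.1)
        have h2 : ⌈(n : ℝ) * σ⌉₊ ≤ n := Nat.ceil_le.2 (by nlinarith [hσ.2])
        exact ⟨Real.rpow_pos_of_pos (by positivity) _, Real.rpow_le_one (by positivity)
          ((div_le_one hn').2 (by exact_mod_cast h2)) (by positivity)⟩
    -- M bounds the kernel averages uniformly in s and h, and |log(1 + t)| ≤ 2|t| applies as soon as
    -- η n * M < 1/2.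
    refine intervalIntegral.tendsto_integral_filter_of_dominated_convergence (fun _ => 2 * M)
      (Eventually.of_forall fun n => ?_) ?_ intervalIntegrable_const
      (Eventually.of_forall fun σ hσ => ?_)
    · have h1 : Measurable fun σ : ℝ => ⌈(n : ℝ) * σ⌉₊ :=
        Nat.measurable_ceil.comp (measurable_const_mul _)
      have h2 : Measurable fun i : ℕ => (η n)⁻¹ * Real.log (1 + η n * b n i) :=
        measurable_from_top
      exact (h2.comp h1).aestronglyMeasurable
    · have hsmall : ∀ᶠ n in atTop, η n * M < 1 / 2 := by
        have : Tendsto (fun n => η n * M) atTop (𝓝 0) := by simpa using hη.mul_const M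
        exact this.eventually_lt_const (by norm_num)
      filter_upwards [hη0, hsmall, eventually_gt_atTop 0] with n hn hsm hn0
      refine Eventually.of_forall fun σ hσ => ?_
      rw [uIoc_of_le zero_le_one] at hσ
      obtain ⟨h1, h2⟩ := hceil σ hσ n hn0
      have h3 : |b n ⌈(n : ℝ) * σ⌉₊| ≤ M := hb _ _ h1 h2
      have h4 : |η n * b n ⌈(n : ℝ) * σ⌉₊| ≤ η n * M := by
        rw [abs_mul, abs_of_pos hn]
        gcongr
      have h5 := abs_log_one_add_le (h4.trans hsm.le)
      rw [norm_mul, norm_inv, Real.norm_of_nonneg hn.le, Real.norm_eq_abs, inv_mul_le_iff₀ hn]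
      linarith
    · rw [uIoc_of_le zero_le_one] at hσ
      refine tendsto_inv_mul_log_one_add hη hη0 ?_
      have hc1 : Tendsto (fun n : ℕ => (⌈(n : ℝ) * σ⌉₊ : ℝ) / n) atTop (𝓝 σ) := by
        have := (tendsto_nat_ceil_mul_div_atTop (R := ℝ) hσ.1.le).comp
          (tendsto_natCast_atTop_atTop (R := ℝ))
        simpa [Function.comp_def, mul_comm] using this
      -- For fixed σ > 0 the index ⌈nσ⌉ tends to infinity, so its own bandwidth vanishes.
      have hc2 : Tendsto (fun n : ℕ => ⌈(n : ℝ) * σ⌉₊) atTop atTop :=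
        (tendsto_nat_ceil_atTop (α := ℝ)).comp
          ((tendsto_natCast_atTop_atTop (R := ℝ)).atTop_mul_const hσ.1)
      refine hA2.tendsto_kernelIncrement hA1' hs.measurable_density hs.density_nonneg hKm hK hC hKC
        l.fst l.snd (hc1.rpow_const (Or.inl hσ.1.ne')) (Real.rpow_pos_of_pos hσ.1 _) ?_
        ((tendsto_bandwidth ha).comp hc2)
      filter_upwards [eventually_gt_atTop 0] with n hn
      exact hceil σ hσ n hn

/-! ### Transfer from the pair to the ratio. -/

omit [MeasurableSpace Ω] in
lemma rTilde_mem_of_pairTilde {h : ℕ → ℝ} {S : Set (EuclideanSpace ℝ (Fin q))} {n : ℕ} {ω : Ω}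
    (hω : (pairTilde K h X Y x n ω).snd ≠ 0 ∧
      ((pairTilde K h X Y x n ω).snd)⁻¹ • (pairTilde K h X Y x n ω).fst ∈ S) :
    rTilde K h X Y x n ω ∈ S := by
  have h1 : gTilde K h X x n ω ≠ 0 := hω.1
  rw [rTilde, if_pos h1]
  exact hω.2

omit [MeasurableSpace Ω] in
lemma pairTilde_of_rTilde_mem {h : ℕ → ℝ} {S : Set (EuclideanSpace ℝ (Fin q))} {n : ℕ} {ω : Ω}
    (hω : rTilde K h X Y x n ω ∈ S) :
    (pairTilde K h X Y x n ω).snd ≠ 0 →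
      ((pairTilde K h X Y x n ω).snd)⁻¹ • (pairTilde K h X Y x n ω).fst ∈ S := by
  intro h1
  have h1' : gTilde K h X x n ω ≠ 0 := h1
  rw [rTilde, if_pos h1'] at hω
  exact hω

lemma legendre_psiTilde (y : WithLp 2 (EuclideanSpace ℝ (Fin q) × ℝ)) :
    LargeDeviations.legendre (fun l : WithLp 2 (EuclideanSpace ℝ (Fin q) × ℝ) =>
      PsiTilde K f a x l.fst l.snd) y = ITilde K f a x y.fst y.snd := by
  have h : ∀ l : WithLp 2 (EuclideanSpace ℝ (Fin q) × ℝ),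
      ⟪l, y⟫ = ⟪l.fst, y.fst⟫ + l.snd * y.snd := fun l => by
    rw [WithLp.prod_inner_apply, Real.inner_apply]
    rfl
  simp only [LargeDeviations.legendre, ITilde, h]
  refine le_antisymm (iSup_le fun l => le_iSup₂_of_le l.fst l.snd le_rfl)
    (iSup₂_le fun u v => le_iSup_of_le (WithLp.toLp 2 (u, v)) le_rfl)

lemma isOpen_ratio_mem {U : Set (EuclideanSpace ℝ (Fin q))} (hU : IsOpen U) :
    IsOpen {p : WithLp 2 (EuclideanSpace ℝ (Fin q) × ℝ) | p.snd ≠ 0 ∧ p.snd⁻¹ • p.fst ∈ U} := by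
  have h2 : Continuous fun p : WithLp 2 (EuclideanSpace ℝ (Fin q) × ℝ) => p.snd := by fun_prop
  have h1 : Continuous fun p : WithLp 2 (EuclideanSpace ℝ (Fin q) × ℝ) => p.fst := by fun_prop
  have hc : ContinuousOn (fun p : WithLp 2 (EuclideanSpace ℝ (Fin q) × ℝ) => p.snd⁻¹ • p.fst)
      {p | p.snd ≠ 0} := (h2.continuousOn.inv₀ fun p hp => hp).smul h1.continuousOn
  exact hc.isOpen_inter_preimage (isOpen_ne_fun h2 continuous_const) hU

section MeasurableKernel

variable [IsProbabilityMeasure μ] (hs : IsSample μ X Y f) (hd : 0 < d)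
    (hc : 0 < c) (ha : 0 < a) (had : a < 1 / (d : ℝ)) (hA2 : CondA2 f x) (hA1' : CondA1' f x)
    (hKm : Measurable K) (hK : Integrable K) {C : ℝ} (hC : 0 ≤ C) (hKC : ∀ z, |K z| ≤ C)
include hs hd hc ha had hA2 hA1' hKm hK hC hKC

/-- The open set of pairs with nonzero denominator and ratio in U contains every (ts, t) with s ∈ U
and t ≠ 0, the points over which the infima in J̃* run. -/
theorem IsSample.neg_iInf_JStar_le_liminf {U : Set (EuclideanSpace ℝ (Fin q))} (hU : IsOpen U) :
    -(⨅ s ∈ U, JStar K f a x s) ≤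
      liminf (scaledLogProb μ K (bandwidth c a) X Y x U) atTop := by
  have hGE := (hs.hasLimitingCgf hd hc ha had hA2 hA1' hKm hK hC hKC).le_liminf
    (hA2.differentiable_psiTilde hs.measurable_density hs.density_nonneg hKm hK hC hKC ha)
    (isOpen_ratio_mem hU)
  refine le_trans ?_ (hGE.trans (liminf_le_liminf ?_))
  · rw [EReal.neg_le_neg_iff]
    refine le_iInf₂ fun s hsU => le_iInf₂ fun t ht => ?_
    refine (iInf₂_le (WithLp.toLp 2 (t • s, t)) ⟨ht, ?_⟩).trans (legendre_psiTilde _).le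
    simpa [inv_smul_smul₀ ht] using hsU
  · filter_upwards [eventually_gt_atTop 0] with n hn
    rw [LargeDeviations.scaledLog, scaledLogProb, one_div]
    have := pow_pos (bandwidth_pos (a := a) hc hn) d
    exact mul_le_mul_of_nonneg_left
      (ENNReal.log_monotone (measure_mono fun ω hω => rTilde_mem_of_pairTilde hω))
      (EReal.coe_nonneg.2 (by positivity))

/-- The set of pairs is closed because it contains the whole hyperplane of zero denominators; (C')
bounds the rate there below by Ĩ(0, 0). -/
theorem IsSample.limsup_le_neg_iInf_JTilde (hC' : CondC' K f a x)
    {V : Set (EuclideanSpace ℝ (Fin q))} (hV : IsClosed V) :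
    limsup (scaledLogProb μ K (bandwidth c a) X Y x V) atTop ≤ -(⨅ s ∈ V, JTilde K f a x s) := by
  -- For empty V the hyperplane would still contribute a possibly finite rate, whereas the event
  -- itself is impossible.
  rcases V.eq_empty_or_nonempty with rfl | ⟨s₀, hs₀⟩
  · refine limsup_le_of_le (by isBoundedDefault) ?_
    filter_upwards [eventually_gt_atTop 0] with n hn
    have := pow_pos (bandwidth_pos (a := a) hc hn) d
    have hpos : (0 : ℝ) < 1 / ((n : ℝ) * bandwidth c a n ^ d) := by positivity
    simp only [scaledLogProb, mem_empty_iff_false]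
    have h0 : μ {_ω : Ω | False} = 0 := measure_empty
    rw [h0, ENNReal.log_zero, EReal.coe_mul_bot_of_pos hpos]
    exact bot_le
  have hF : IsClosed {p : WithLp 2 (EuclideanSpace ℝ (Fin q) × ℝ) |
      p.snd ≠ 0 → p.snd⁻¹ • p.fst ∈ V} := by
    convert (isOpen_ratio_mem hV.isOpen_compl).isClosed_compl using 1
    ext p
    simp
  refine le_trans (limsup_le_limsup ?_)
    (((hs.hasLimitingCgf hd hc ha had hA2 hA1' hKm hK hC hKC).limsup_le hF).trans ?_)
  · filter_upwards [eventually_gt_atTop 0] with n hn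
    rw [LargeDeviations.scaledLog, scaledLogProb, one_div]
    have := pow_pos (bandwidth_pos (a := a) hc hn) d
    exact mul_le_mul_of_nonneg_left
      (ENNReal.log_monotone (measure_mono fun ω hω => pairTilde_of_rTilde_mem hω))
      (EReal.coe_nonneg.2 (by positivity))
  · rw [EReal.neg_le_neg_iff]
    refine le_iInf₂ fun p hp => ?_
    rw [legendre_psiTilde]
    -- On the hyperplane any s₀ ∈ V serves, since Ĩ(0, 0) enters J̃(s) for every s.
    by_cases h0 : p.snd = 0
    · rw [h0]
      refine (iInf₂_le s₀ hs₀).trans ((min_le_right _ _).trans ?_)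
      rw [← show ⨅ s, ITilde K f a x s 0 = ITilde K f a x 0 0 from hC']
      exact iInf_le _ _
    · refine (iInf₂_le _ (hp h0)).trans ((min_le_left _ _).trans ((iInf₂_le p.snd h0).trans ?_))
      rw [smul_inv_smul₀ h0]

end MeasurableKernel

/-! ### Reduction to a Borel measurable kernel. -/

section Congr

lemma PsiTilde_congr {K' : EuclideanSpace ℝ (Fin d) → ℝ} (h : K =ᵐ[volume] K') :
    PsiTilde K f a x = PsiTilde K' f a x := by
  ext u v
  refine integral_congr_ae ?_
  have h1 : ∀ᵐ p : EuclideanSpace ℝ (Fin d) × EuclideanSpace ℝ (Fin q), K p.1 = K' p.1 := by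
    rw [Measure.volume_eq_prod]
    exact Measure.quasiMeasurePreserving_fst.ae h
  have h2 : ∀ᵐ p : ℝ × EuclideanSpace ℝ (Fin d) × EuclideanSpace ℝ (Fin q)
      ∂((volume.restrict (Icc (0 : ℝ) 1)).prod volume), K p.2.1 = K' p.2.1 :=
    Measure.quasiMeasurePreserving_snd.ae h1
  filter_upwards [h2] with p hp
  rw [hp]

/-- (X_i, Y_i) has a density and t ↦ (x - t)/h_i is nonsingular, so changing K on a null set affects
each term with probability zero; there are countably many terms. -/
lemma IsSample.rTilde_ae_eq (hs : IsSample μ X Y f) {K' : EuclideanSpace ℝ (Fin d) → ℝ}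
    (h : K =ᵐ[volume] K') (hc : 0 < c) :
    ∀ᵐ ω ∂μ, ∀ n, rTilde K (bandwidth c a) X Y x n ω = rTilde K' (bandwidth c a) X Y x n ω := by
  have h1 : ∀ᵐ ω ∂μ, ∀ i, 0 < i → K ((bandwidth c a i)⁻¹ • (x - X i ω)) =
      K' ((bandwidth c a i)⁻¹ • (x - X i ω)) := by
    refine ae_all_iff.2 fun i => ?_
    rcases Nat.eq_zero_or_pos i with rfl | hi
    · simp
    have hb := bandwidth_pos (a := a) hc hi
    have hT : Measure.QuasiMeasurePreserving
        (fun t : EuclideanSpace ℝ (Fin d) => (bandwidth c a i)⁻¹ • (x - t)) volume volume :=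
      ⟨by fun_prop, by
        rw [map_inv_smul_sub x hb]
        exact Measure.smul_absolutelyContinuous⟩
    have h2 : ∀ᵐ p : EuclideanSpace ℝ (Fin d) × EuclideanSpace ℝ (Fin q),
        K ((bandwidth c a i)⁻¹ • (x - p.1)) = K' ((bandwidth c a i)⁻¹ • (x - p.1)) := by
      rw [Measure.volume_eq_prod]
      exact (hT.comp Measure.quasiMeasurePreserving_fst).ae h
    have h3 : ∀ᵐ p ∂(μ.map fun ω => (X i ω, Y i ω)),
        K ((bandwidth c a i)⁻¹ • (x - p.1)) = K' ((bandwidth c a i)⁻¹ • (x - p.1)) := by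
      rw [hs.law i]
      exact withDensity_absolutelyContinuous _ _ h2
    filter_upwards [ae_of_ae_map ((hs.measurable_X i).prodMk (hs.measurable_Y i)).aemeasurable h3]
      with ω hω _ using hω
  filter_upwards [h1] with ω hω n
  have hg : gTilde K (bandwidth c a) X x n ω = gTilde K' (bandwidth c a) X x n ω := by
    simp only [gTilde]
    congr 1
    exact Finset.sum_congr rfl fun i hi => by rw [hω i (Finset.mem_Icc.1 hi).1]
  have hm : mTilde K (bandwidth c a) X Y x n ω = mTilde K' (bandwidth c a) X Y x n ω := by
    simp only [mTilde]
    congr 1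
    exact Finset.sum_congr rfl fun i hi => by rw [hω i (Finset.mem_Icc.1 hi).1]
  simp only [rTilde, hg, hm]

/-- A measurable representative agrees with K only almost everywhere, so it is clipped to [-C, C] to
restore the bound at every point. -/
lemma CondA1.exists_measurable (hA1 : CondA1 K) :
    ∃ (K' : EuclideanSpace ℝ (Fin d) → ℝ) (C : ℝ), K =ᵐ[volume] K' ∧ Measurable K' ∧
      Integrable K' ∧ 0 ≤ C ∧ ∀ z, |K' z| ≤ C := by
  obtain ⟨C, hC⟩ := hA1.bounded
  have hC0 : 0 ≤ C := (abs_nonneg _).trans (hC 0)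
  have hm := hA1.integrable.aestronglyMeasurable
  set K' : EuclideanSpace ℝ (Fin d) → ℝ := fun z => max (-C) (min (hm.mk K z) C)
  have hae : K =ᵐ[volume] K' := by
    filter_upwards [hm.ae_eq_mk] with z hz
    obtain ⟨h1, h2⟩ := abs_le.1 (hC z)
    simp only [K', ← hz, min_eq_left h2, max_eq_right h1]
  refine ⟨K', C, hae, ?_, hA1.integrable.congr hae, hC0, fun z => abs_le.2
    ⟨le_max_left _ _, max_le (by linarith) (min_le_right _ _)⟩⟩
  exact measurable_const.max (hm.stronglyMeasurable_mk.measurable.min measurable_const)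

end Congr

end SemiRecursive

theorem theorem3 {d q : ℕ} (hd : 0 < d)
    {Ω : Type*} [MeasurableSpace Ω] (μ : Measure Ω) [IsProbabilityMeasure μ]
    (X : ℕ → Ω → EuclideanSpace ℝ (Fin d)) (Y : ℕ → Ω → EuclideanSpace ℝ (Fin q))
    (f : EuclideanSpace ℝ (Fin d) → EuclideanSpace ℝ (Fin q) → ℝ)
    (hsample : SemiRecursive.IsSample μ X Y f)
    (K : EuclideanSpace ℝ (Fin d) → ℝ) (x : EuclideanSpace ℝ (Fin d))
    (c a : ℝ) (hc : 0 < c) (ha : 0 < a) (had : a < 1 / (d : ℝ))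
    (hA1 : SemiRecursive.CondA1 K) (hA2 : SemiRecursive.CondA2 f x)
    (hA1' : SemiRecursive.CondA1' f x) (hC' : SemiRecursive.CondC' K f a x) :
    (∀ U : Set (EuclideanSpace ℝ (Fin q)), IsOpen U →
      -(⨅ s ∈ U, SemiRecursive.JStar K f a x s) ≤
        liminf (SemiRecursive.scaledLogProb μ K (SemiRecursive.bandwidth c a) X Y x U) atTop) ∧
    (∀ V : Set (EuclideanSpace ℝ (Fin q)), IsClosed V →
      limsup (SemiRecursive.scaledLogProb μ K (SemiRecursive.bandwidth c a) X Y x V) atTop ≤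
        -(⨅ s ∈ V, SemiRecursive.JTilde K f a x s)) := by
  obtain ⟨K', C, hae, hKm, hK, hC, hKC⟩ := hA1.exists_measurable
  have hI : SemiRecursive.ITilde K f a x = SemiRecursive.ITilde K' f a x := by
    ext t₁ t₂
    simp only [SemiRecursive.ITilde, SemiRecursive.PsiTilde_congr hae]
  have hJs : SemiRecursive.JStar K f a x = SemiRecursive.JStar K' f a x := by
    ext s
    simp only [SemiRecursive.JStar, hI]
  have hJ : SemiRecursive.JTilde K f a x = SemiRecursive.JTilde K' f a x := by
    ext s
    simp only [SemiRecursive.JTilde, hI, hJs]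
  have hP : ∀ S, SemiRecursive.scaledLogProb μ K (SemiRecursive.bandwidth c a) X Y x S =
      SemiRecursive.scaledLogProb μ K' (SemiRecursive.bandwidth c a) X Y x S := fun S => by
    ext n
    rw [SemiRecursive.scaledLogProb, SemiRecursive.scaledLogProb]
    congr 2
    refine measure_congr ?_
    filter_upwards [hsample.rTilde_ae_eq (x := x) (a := a) hae hc] with ω hω
    exact congrArg (· ∈ S) (hω n)
  rw [SemiRecursive.CondC', hI] at hC'
  simp only [hJs, hJ, hP]
  exact ⟨fun U hU => hsample.neg_iInf_JStar_le_liminf hd hc ha had hA2 hA1' hKm hK hC hKC hU,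
    fun V hV => hsample.limsup_le_neg_iInf_JTilde hd hc ha had hA2 hA1' hKm hK hC hKC hC' hV⟩
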